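/- Let $\omega=\sum_{i=1}^n\omega_i\delta_{x_i}$ and $v=\sum_{i=1}^n v_i\delta_{x_i}$ be finitely supported measures on $\mathbb R$ with $x_1<\dots<x_n$, $\omega_i\in\mathbb R$, $v_i\ge 0$ and $|\omega_i|+v_i>0$. Consider the spectral problem $$-f''+\tfrac14 f=z\,\omega f+z^2 v f\quad\text{on }\mathbb R,\qquad z\in\mathbb C,$$ meaning that $f$ is continuous, $-f''+\frac14 f=0$ off $\{x_1,\dots,x_n\}$, and $f'(x_i-)=f'(x_i+)+z\omega_i f(x_i)+z^2v_i f(x_i)$ for all $i$. Its eigenvalues, that is, those $z$ for which there is a nontrivial bounded solution, are real, nonzero and finite in number: $\lambda_1<\dots<\lambda_N$. Let $\phi_+(z,\cdot)$ be the solution that equals $e^{-x/2}$ for all $x$ near $+\infty$, put $$\gamma_{\lambda_i}^2=\int|\phi_+(\lambda_i,x)|^2\,d\omega(x)+2\lambda_i\int|\phi_+(\lambda_i,x)|^2\,dv(x),\qquad \varphi_i(x)=\frac{\phi_+(\lambda_i,x)}{\sqrt{\lambda_i\gamma_{\lambda_i}^2}},$$ and for $a\in\mathbb R$ call $\{\lambda_i,\varphi_i(a)\}_{i=1}^N$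 the interior spectral data of $(\omega,v)$ at $a$. Theorem. Fix $a\in\mathbb R$ and let $\{\lambda_i,\varphi_i(a)\}_{i=1}^N$ be the interior spectral data at $a$ of some pair $(\omega,v)$ as above. Assume that $$1-\sum_{i=1}^N|\varphi_i(a)|^2=0,\qquad -\sum_{i=1}^N\lambda_i|\varphi_i(a)|^2\neq0,\qquad \varphi_i(a)\ne0\quad(i=1,\dots,N).$$ (i) If $\lambda_1>0$ or $\lambda_N<0$, then $(\omega,v)$ is the only pair of measures of the above form with these interior spectral data at $a$. (ii) If $\lambda_{j_0}<0<\lambda_{j_0+1}$ for some $j_0\in\{1,\dots,N-1\}$, then exactly two pairs of measures of the above form have these interior spectral data at $a$. -/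

import Mathlib

open scoped NNReal

/-!
A pair of discrete measures `ω = ∑ ωᵢ δ_{xᵢ}` (real weights) and `v = ∑ vᵢ δ_{xᵢ}` (non-negative
weights) with finitely many nodes is given by the finitely supported functions `x ↦ ω({x})` and
`x ↦ v({x})`. The nodes `xᵢ` are the points at which at least one of the two weights is nonzero.
-/

namespace CHSpectral

/-- `x` is a node of the pair `(ω, v)`. -/
def IsNode (ω : ℝ →₀ ℝ) (v : ℝ →₀ ℝ≥0) (x : ℝ) : Prop := ω x ≠ 0 ∨ v x ≠ 0

/-- `f` solves `-f'' + f / 4 = z ω f + z² v f` on the real line: `f` is continuous, satisfies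
`-f'' + f / 4 = 0` off the nodes, and at each node `x` the one-sided limits of `f'` exist and
`f'(x-) = f'(x+) + z ω({x}) f(x) + z² v({x}) f(x)`. -/
structure IsSolution (ω : ℝ →₀ ℝ) (v : ℝ →₀ ℝ≥0) (z : ℂ) (f : ℝ → ℂ) : Prop where
  continuous : Continuous f
  differentiableAt : ∀ x, ¬ IsNode ω v x → DifferentiableAt ℝ f x
  equation : ∀ x, ¬ IsNode ω v x → ∃ f₂ : ℂ, HasDerivAt (deriv f) f₂ x ∧ -f₂ + f x / 4 = 0
  jump : ∀ x, IsNode ω v x → ∃ dl dr : ℂ,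
    Filter.Tendsto (deriv f) (nhdsWithin x (Set.Iio x)) (nhds dl) ∧
    Filter.Tendsto (deriv f) (nhdsWithin x (Set.Ioi x)) (nhds dr) ∧
    dl = dr + z * (ω x : ℂ) * f x + z ^ 2 * ((v x : ℝ) : ℂ) * f x

/-- The spectrum: all complex `z` for which there is a nontrivial bounded solution. -/
def spectrum (ω : ℝ →₀ ℝ) (v : ℝ →₀ ℝ≥0) : Set ℂ :=
  {z | ∃ f : ℝ → ℂ, IsSolution ω v z f ∧ f ≠ 0 ∧ ∃ C : ℝ, ∀ x, ‖f x‖ ≤ C}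

/-- `φ` is the solution `φ₊(z, ·)`, which equals `exp (-x / 2)` for all `x` near `+∞`. -/
def IsPhiPlus (ω : ℝ →₀ ℝ) (v : ℝ →₀ ℝ≥0) (z : ℂ) (φ : ℝ → ℂ) : Prop :=
  IsSolution ω v z φ ∧ ∀ᶠ x : ℝ in Filter.atTop, φ x = (Real.exp (-x / 2) : ℂ)

/-- `γ² = ∫ |φ|² dω + 2 λ ∫ |φ|² dv`. -/
noncomputable def gammaSq (ω : ℝ →₀ ℝ) (v : ℝ →₀ ℝ≥0) (lam : ℝ) (φ : ℝ → ℂ) : ℝ :=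
  (ω.sum fun x m => m * ‖φ x‖ ^ 2) + 2 * lam * (v.sum fun x m => (m : ℝ) * ‖φ x‖ ^ 2)

/-- `(λᵢ, pᵢ)` is the interior spectral data at `a` of the pair `(ω, v)`: the `λᵢ` are all the
eigenvalues, in increasing order, and `pᵢ` is the value at `a` of the normalized eigenfunction
`φ₊(λᵢ, ·) / √(λᵢ γ²)`. The solution `φ₊(λᵢ, ·)` is determined by `IsPhiPlus`. -/
structure IsInteriorSpectralData (a : ℝ) (ω : ℝ →₀ ℝ) (v : ℝ →₀ ℝ≥0) {N : ℕ}
    (lam p : Fin N → ℝ) : Prop where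
  strictMono : StrictMono lam
  spectrum_eq : spectrum ω v = Set.range fun i => (lam i : ℂ)
  value : ∀ i, ∃ φ : ℝ → ℂ, IsPhiPlus ω v (lam i) φ ∧
    (p i : ℂ) = φ a / (Real.sqrt (lam i * gammaSq ω v (lam i) φ) : ℂ)

end CHSpectral

/-! Let Y₊ = e^{a/2} φ₊(·, a), let Y₋ be its mirror image from the left, and let W be the Wronskian
of the two decaying solutions. All are polynomials in z equal to 1 at 0, and the zeros of W are the
eigenvalues. With masses w, u of ω, v at a, W = (1 - wz - uz²) Y₊Y₋ - zE₊Y₋ - zE₋Y₊, and at an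
eigenvalue a Lagrange identity gives Y₊Y₋(λ) = -λ W'(λ) p². So the data amount to W, the values of P
= Y₊Y₋ at the eigenvalues, and the signs of Y₊ there.

By summing residues, 1 - ∑ p² and β = -∑ λp² are, up to the leading coefficient of W, the
coefficients of P at z^N and then at z^{N-1}. Hence deg P = N - 1, P is determined by interpolation,
and comparison of leading terms gives u = 0 and wβ = -1 (`HasData.splitting_facts`). Only the
factorisation of P is left open. A half-line is recovered from (Y, E) by a Stieltjes continued
fraction (`list_ext_of_polys`, `exists_list_of_isNevanlinna`), and E₊, E₋ from W by partial
fractions.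

For two factorisations (Y₊, Y₋), (Z₊, Z₋), one of Y₊Z₋, Z₊Y₋ has degree below N, say the first.
Since the signs agree, zY₊Z₋/W is a Herglotz function with residues -λ²c, c > 0. So Y₊ and Z₋ are
coprime and Y₊ divides Z₊. Because ∑ λ²c > 0 the quotient has degree at most one, and degree one
forces ∑ λc = 0, which is impossible for eigenvalues of one sign (`HasData.exists_factor`). In
general distinct solutions have deg Y₊ differing by exactly one, so parity allows at most two.

If eigenvalues of both signs occur, zP/W tends to β ≠ 0 at infinity, so P has a zero μ beyond all
eigenvalues on one side (`HasData.exists_root_outside`). The factor 1 - z/μ is positive at every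
eigenvalue and can be moved between Y₊ and Y₋, which gives the second solution. -/

namespace CHSpectral

open Polynomial Filter Topology

/-! ### Polynomials with real simple zeros -/

theorem splits_of_aeval_eq_zero_imp_im {M : ℝ[X]}
    (h : ∀ z : ℂ, aeval z M = 0 → z.im = 0) : M.Splits := by
  refine Splits.of_splits_map (algebraMap ℝ ℂ) (IsAlgClosed.splits _) ?_
  intro z hz
  have hz' : aeval z M = 0 := by
    have := (mem_roots'.1 hz).2
    rwa [IsRoot.def, eval_map_algebraMap] at this
  exact ⟨z.re, Complex.ext (by simp) (by simp [h z hz'])⟩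

theorem eq_C_mul_nodal_roots {M : ℝ[X]} (hs : M.Splits)
    (hd : ∀ μ, M.eval μ = 0 → M.derivative.eval μ ≠ 0) :
    M = C M.leadingCoeff * Lagrange.nodal M.roots.toFinset id := by
  rcases eq_or_ne M 0 with rfl | h0
  · simp
  have hnd : M.roots.Nodup := by
    rw [Multiset.nodup_iff_count_le_one]
    intro μ
    by_contra hlt
    rw [not_le, count_roots, one_lt_rootMultiplicity_iff_isRoot h0] at hlt
    exact hd μ hlt.1 hlt.2
  conv_lhs => rw [hs.eq_prod_roots]
  rw [Lagrange.nodal, Finset.prod, Multiset.toFinset_val, hnd.dedup]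
  rfl

/-! ### Lagrange interpolation and residues -/

section Interpolation

variable {ι : Type*} [DecidableEq ι] {s : Finset ι} {v : ι → ℝ} {k : ℝ}

theorem eval_derivative_C_mul_nodal {i : ι} (hi : i ∈ s) :
    (derivative (C k * Lagrange.nodal s v)).eval (v i) =
      k * (Lagrange.nodal (s.erase i) v).eval (v i) := by
  rw [derivative_C_mul, eval_mul, eval_C, Lagrange.eval_nodal_derivative_eval_node_eq hi]

theorem eval_derivative_C_mul_nodal_ne_zero (hv : Set.InjOn v s) (hk : k ≠ 0) {i : ι}
    (hi : i ∈ s) : (derivative (C k * Lagrange.nodal s v)).eval (v i) ≠ 0 := by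
  rw [eval_derivative_C_mul_nodal hi, Lagrange.eval_nodal]
  refine mul_ne_zero hk (Finset.prod_ne_zero_iff.2 fun j hj => sub_ne_zero.2 fun h => ?_)
  exact (Finset.mem_erase.1 hj).1 (hv (Finset.mem_erase.1 hj).2 hi h.symm)

theorem eq_sum_residues (hv : Set.InjOn v s) (hk : k ≠ 0) {N : ℝ[X]} (hN : N.degree < s.card) :
    N = ∑ i ∈ s, C (N.eval (v i) / (derivative (C k * Lagrange.nodal s v)).eval (v i)) *
      (C k * Lagrange.nodal (s.erase i) v) := by
  refine (Lagrange.eq_interpolate hv hN).trans ?_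
  symm
  refine Lagrange.eq_interpolate_of_eval_eq _ hv ?_ ?_
  · refine (degree_sum_le _ _).trans_lt ?_
    refine (Finset.sup_lt_iff (WithBot.bot_lt_coe _)).2 fun i hi => ?_
    rw [← mul_assoc, ← C_mul]
    refine (degree_mul_le_of_le degree_C_le le_rfl).trans_lt ?_
    rw [zero_add, Lagrange.degree_nodal, Nat.cast_lt]
    exact Finset.card_erase_lt_of_mem hi
  · intro i hi
    rw [eval_finsetSum, Finset.sum_eq_single_of_mem i hi]
    · have h := eval_derivative_C_mul_nodal_ne_zero hv hk hi
      rw [eval_mul, eval_mul, eval_C, eval_C, ← eval_derivative_C_mul_nodal hi,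
        div_mul_cancel₀ _ h]
    · intro j hj hji
      rw [eval_mul, eval_mul, Lagrange.eval_nodal_at_node (Finset.mem_erase.2 ⟨hji.symm, hi⟩)]
      simp

/-- The residues of `N / M` add up to its `1/z` coefficient at infinity. This is what turns sums
over the eigenvalues into statements about degrees. -/
theorem coeff_eq_sum_residues (hv : Set.InjOn v s) (hk : k ≠ 0) {N : ℝ[X]}
    (hN : N.degree < s.card) :
    N.coeff (s.card - 1) =
      k * ∑ i ∈ s, N.eval (v i) / (derivative (C k * Lagrange.nodal s v)).eval (v i) := by
  rw [Lagrange.coeff_eq_sum hv hN, Finset.mul_sum]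
  refine Finset.sum_congr rfl fun i hi => ?_
  rw [eval_derivative_C_mul_nodal hi, Lagrange.eval_nodal]
  field_simp

/-- The Wronskian of two polynomials as a form in two evaluation points. -/
theorem wronskian_sum_residues {A : Type*} [CommRing A] [Algebra ℝ A] (ρ : ι → ℝ) (c d : ℝ)
    (x y : A) :
    let M := C k * Lagrange.nodal s v
    let R := fun i => C k * Lagrange.nodal (s.erase i) v
    let N := (C c * X + C d) * M + ∑ i ∈ s, C (ρ i) * R i
    aeval x N * aeval y M - aeval y N * aeval x M = (x - y) *
      (algebraMap ℝ A c * (aeval x M * aeval y M) -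
        ∑ i ∈ s, algebraMap ℝ A (ρ i) * (aeval x (R i) * aeval y (R i))) := by
  intro M R N
  have hM : ∀ i ∈ s, M = (X - C (v i)) * R i := fun i hi => by
    simp only [M, R, Lagrange.nodal_eq_mul_nodal_erase hi]; ring
  simp only [N, map_add, map_mul, aeval_X, aeval_C, map_sum, add_mul, Finset.sum_mul, mul_sub,
    Finset.mul_sum]
  rw [← sub_eq_zero]
  have : ∀ i ∈ s, algebraMap ℝ A (ρ i) * aeval x (R i) * aeval y M =
      algebraMap ℝ A (ρ i) * aeval y (R i) * aeval x M -
        (x - y) * (algebraMap ℝ A (ρ i) * (aeval x (R i) * aeval y (R i))) := fun i hi => by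
    rw [hM i hi]
    simp only [map_mul, map_sub, aeval_X, aeval_C]
    ring
  rw [Finset.sum_congr rfl this, Finset.sum_sub_distrib]
  ring

/-- The diagonal case of `wronskian_sum_residues`: divide by `x - y` and let `y` tend to `x`. -/
theorem wronskian_derivative_sum_residues (ρ : ι → ℝ) (c d : ℝ) :
    let M := C k * Lagrange.nodal s v
    let R := fun i => C k * Lagrange.nodal (s.erase i) v
    let N := (C c * X + C d) * M + ∑ i ∈ s, C (ρ i) * R i
    derivative N * M - N * derivative M = C c * M ^ 2 - ∑ i ∈ s, C (ρ i) * R i ^ 2 := by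
  intro M R N
  have hM : ∀ i ∈ s, M = (X - C (v i)) * R i := fun i hi => by
    simp only [M, R, Lagrange.nodal_eq_mul_nodal_erase hi]; ring
  simp only [N, derivative_add, derivative_mul, derivative_C, derivative_X, derivative_sum, add_mul,
    Finset.sum_mul]
  have : ∀ i ∈ s, C (ρ i) * derivative (R i) * M =
      C (ρ i) * R i * derivative M - C (ρ i) * R i ^ 2 := fun i hi => by
    rw [hM i hi]
    simp only [derivative_mul, derivative_sub, derivative_X, derivative_C]
    ring
  simp only [zero_mul, zero_add]
  rw [Finset.sum_congr rfl this, Finset.sum_sub_distrib]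
  ring

end Interpolation

/-! ### Rational Herglotz-Nevanlinna functions -/

/-- `N / M` is a rational Herglotz-Nevanlinna function: the poles are real and simple with negative
residues, and the polynomial part is affine with non-negative slope. -/
structure IsNevanlinna (N M : ℝ[X]) : Prop where
  ne_zero : M ≠ 0
  splits : M.Splits
  residue : ∀ μ, M.eval μ = 0 → N.eval μ * M.derivative.eval μ < 0
  natDegree_le : N.natDegree ≤ M.natDegree + 1
  slope : 0 ≤ N.coeff (M.natDegree + 1) * M.leadingCoeff

namespace IsNevanlinna

variable {N M : ℝ[X]}

theorem derivative_ne_zero (h : IsNevanlinna N M) (μ : ℝ) (hμ : M.eval μ = 0) :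
    M.derivative.eval μ ≠ 0 := fun h0 => by
  have := h.residue μ hμ
  rw [h0, mul_zero] at this
  exact this.false

theorem eq_nodal (h : IsNevanlinna N M) :
    M = C M.leadingCoeff * Lagrange.nodal M.roots.toFinset id :=
  eq_C_mul_nodal_roots h.splits h.derivative_ne_zero

theorem natDegree_eq_card (h : IsNevanlinna N M) : M.natDegree = M.roots.toFinset.card := by
  conv_lhs => rw [h.eq_nodal]
  rw [natDegree_C_mul (leadingCoeff_ne_zero.2 h.ne_zero), Lagrange.natDegree_nodal]

theorem exists_div_eq_affine (h : IsNevanlinna N M) :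
    ∃ c d : ℝ, 0 ≤ c ∧ N / M = C c * X + C d ∧
      N.coeff (M.natDegree + 1) = M.leadingCoeff * c := by
  have hk := leadingCoeff_ne_zero.2 h.ne_zero
  have hdm : N = M * (N / M) + N % M := (EuclideanDomain.div_add_mod N M).symm
  have hq : (N / M).natDegree ≤ 1 := by
    by_cases hdeg : M.degree ≤ N.degree
    · have h1 := degree_add_div h.ne_zero hdeg
      have hq0 : N / M ≠ 0 := fun h0 => by
        rw [Polynomial.div_eq_zero_iff h.ne_zero] at h0
        exact absurd hdeg (not_le.2 h0)
      have hN0 : N ≠ 0 := fun h0 => hq0 (by rw [h0, EuclideanDomain.zero_div])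
      rw [degree_eq_natDegree h.ne_zero, degree_eq_natDegree hq0, degree_eq_natDegree hN0] at h1
      have h2 : M.natDegree + (N / M).natDegree = N.natDegree := by exact_mod_cast h1
      have := h.natDegree_le
      omega
    · rw [(Polynomial.div_eq_zero_iff h.ne_zero).2 (not_le.1 hdeg)]; simp
  have h1 := h.slope
  have h2 : N.coeff (M.natDegree + 1) = M.leadingCoeff * (N / M).coeff 1 := by
    conv_lhs => rw [hdm]
    rw [coeff_add, coeff_mul_add_eq_of_natDegree_le le_rfl hq,
      coeff_eq_zero_of_degree_lt (p := N % M), add_zero]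
    · rfl
    · refine (EuclideanDomain.mod_lt N h.ne_zero : (N % M).degree < M.degree).trans_le ?_
      refine degree_le_natDegree.trans ?_
      exact_mod_cast Nat.le_succ _
  refine ⟨_, _, ?_, eq_X_add_C_of_natDegree_le_one hq, h2⟩
  rw [h2] at h1
  have h3 : 0 < M.leadingCoeff ^ 2 := by positivity
  nlinarith

theorem exists_partial_fractions (h : IsNevanlinna N M) :
    ∃ (c d : ℝ) (ρ : ℝ → ℝ), 0 ≤ c ∧ (∀ μ ∈ M.roots.toFinset, ρ μ < 0) ∧
      N = (C c * X + C d) * M + ∑ μ ∈ M.roots.toFinset,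
        C (ρ μ) * (C M.leadingCoeff * Lagrange.nodal (M.roots.toFinset.erase μ) id) ∧
      (N.natDegree < M.natDegree → c = 0 ∧ d = 0) := by
  have hk := leadingCoeff_ne_zero.2 h.ne_zero
  have hr : (N % M).degree < M.roots.toFinset.card := by
    rw [← h.natDegree_eq_card, ← degree_eq_natDegree h.ne_zero]
    exact EuclideanDomain.mod_lt N h.ne_zero
  have hdm : N = M * (N / M) + N % M := (EuclideanDomain.div_add_mod N M).symm
  obtain ⟨c, d, hc, hq, -⟩ := h.exists_div_eq_affine
  have hmodev : ∀ μ, M.eval μ = 0 → (N % M).eval μ = N.eval μ := fun μ hμ => by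
    conv_rhs => rw [hdm]
    simp [hμ]
  have hsum := eq_sum_residues (v := id) Function.injective_id.injOn hk hr
  rw [← h.eq_nodal] at hsum
  refine ⟨c, d, fun μ => (N % M).eval μ / (derivative M).eval μ, hc, ?_, ?_, ?_⟩
  · intro μ hμ
    have hμ0 : M.eval μ = 0 := (mem_roots'.1 (Multiset.mem_toFinset.1 hμ)).2
    have := h.residue μ hμ0
    simp only [hmodev μ hμ0]
    exact div_neg_iff.2 (mul_neg_iff.1 this)
  · rw [← hq]
    conv_lhs => rw [hdm]
    rw [mul_comm M]
    congr 1
  · intro hlt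
    have h0 : N / M = 0 := (Polynomial.div_eq_zero_iff h.ne_zero).2 (degree_lt_degree hlt)
    rw [h0] at hq
    exact ⟨by simpa using (congrArg (coeff · 1) hq).symm,
      by simpa using (congrArg (coeff · 0) hq).symm⟩

/-- A Herglotz function maps the upper half-plane into itself, and so does its negative inverse.
Algebraically, the form `c |M|² - ∑ ρ |R_μ|²` with `R_μ = M / (X - μ)` is positive: off the real
axis it excludes zeros of `N`, on the real axis it makes `N' M` positive at the zeros of `N`. -/
theorem neg_inv (h : IsNevanlinna N M) (hN : N ≠ 0) : IsNevanlinna (-M) N := by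
  obtain ⟨c, d, ρ, hc, hρ, hNeq, hcd⟩ := h.exists_partial_fractions
  have hk := leadingCoeff_ne_zero.2 h.ne_zero
  set k := M.leadingCoeff with hkdef
  set S := M.roots.toFinset with hS
  have hMeq : M = C k * Lagrange.nodal S id := h.eq_nodal
  have hcop : ∀ μ, N.eval μ = 0 → M.eval μ ≠ 0 := fun μ h1 h2 => by
    have := h.residue μ h2
    rw [h1, zero_mul] at this
    exact this.false
  have hRne : ∀ μ ∈ S, ∀ x, M.eval x ≠ 0 → (C k * Lagrange.nodal (S.erase μ) id).eval x ≠ 0 := by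
    intro μ hμ x hx h0
    rw [hMeq, Lagrange.nodal_eq_mul_nodal_erase hμ, eval_mul, eval_mul] at hx
    rw [eval_mul] at h0
    apply hx
    linear_combination (eval x (X - C (id μ))) * h0
  refine ⟨hN, ?_, ?_, ?_, ?_⟩
  · refine splits_of_aeval_eq_zero_imp_im fun z hz => ?_
    by_contra him
    have hMz : aeval z M ≠ 0 := by
      intro h0
      obtain ⟨x, hx⟩ := h.splits.mem_range_of_isRoot h.ne_zero (i := algebraMap ℝ ℂ) (x := z)
        (by rwa [IsRoot.def, eval_map_algebraMap])
      apply him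
      rw [← hx]; simp
    have hconj : ∀ Q : ℝ[X], aeval (starRingEnd ℂ z) Q = starRingEnd ℂ (aeval z Q) := fun Q =>
      aeval_conj Q z
    have hw := wronskian_sum_residues (s := S) (v := id) (k := k) ρ c d z (starRingEnd ℂ z)
    simp only at hw
    rw [← hMeq, ← hNeq, hconj N, hz, map_zero, zero_mul, zero_mul, sub_zero] at hw
    have hzz : z - starRingEnd ℂ z ≠ 0 := by
      intro h0
      apply him
      have := congrArg Complex.im h0
      simp at this
      linarith
    have hw' := (mul_eq_zero.1 hw.symm).resolve_left hzz
    simp only [hconj, Complex.mul_conj, Complex.coe_algebraMap] at hw'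
    have hw2 : c * Complex.normSq (aeval z M) - ∑ μ ∈ S,
        ρ μ * Complex.normSq (aeval z (C k * Lagrange.nodal (S.erase μ) id)) = 0 := by
      exact_mod_cast hw'
    have hnM : 0 < Complex.normSq (aeval z M) := Complex.normSq_pos.2 hMz
    have hSle : ∀ μ ∈ S, ρ μ * Complex.normSq (aeval z (C k * Lagrange.nodal (S.erase μ) id)) < 0 := by
      intro μ hμ
      refine mul_neg_of_neg_of_pos (hρ μ hμ) (Complex.normSq_pos.2 fun h0 => hMz ?_)
      rw [hMeq, Lagrange.nodal_eq_mul_nodal_erase hμ, mul_left_comm, map_mul, h0, mul_zero]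
    -- Both parts of the form are nonnegative, so its vanishing leaves no poles and `c = 0`; then
    -- `N` is `d` times a nonzero constant, with a zero only if it vanishes identically.
    have hSe : S = ∅ := by
      by_contra hne
      have := Finset.sum_neg hSle (Finset.nonempty_iff_ne_empty.2 hne)
      nlinarith [mul_nonneg hc hnM.le]
    rw [hSe, Finset.sum_empty, sub_zero] at hw2
    have hc0 : c = 0 := (mul_eq_zero.1 hw2).resolve_right hnM.ne'
    rw [hSe, Lagrange.nodal_empty, mul_one] at hMeq
    rw [hNeq, hSe, Finset.sum_empty, add_zero, hc0] at hz
    simp only [map_zero, zero_mul, zero_add, map_mul, mul_eq_zero, hMz, or_false, aeval_C,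
      Complex.coe_algebraMap] at hz
    apply hN
    have hd : d = 0 := by exact_mod_cast hz
    rw [hNeq, hSe, hc0, hd]; simp
  · intro ν hν
    have hM := hcop ν hν
    have hw := wronskian_derivative_sum_residues (s := S) (v := id) (k := k) ρ c d
    simp only at hw
    rw [← hMeq, ← hNeq] at hw
    have hw2 := congrArg (eval ν) hw
    simp only [eval_sub, eval_mul (p := C _), eval_mul (q := M), eval_mul (p := N), hν, zero_mul,
      sub_zero, eval_C, eval_pow, eval_finsetSum] at hw2
    rw [eval_neg, neg_mul, neg_lt_zero, mul_comm, hw2]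
    have hnM : 0 < eval ν M ^ 2 := by positivity
    have hSle : ∀ μ ∈ S, ρ μ * (eval ν (C k * Lagrange.nodal (S.erase μ) id)) ^ 2 < 0 := by
      intro μ hμ
      have := hRne μ hμ ν hM
      exact mul_neg_of_neg_of_pos (hρ μ hμ) (by positivity)
    simp only [eval_mul (p := C k), eval_C] at hSle
    rcases S.eq_empty_or_nonempty with hSe | hSe
    · rw [hSe, Finset.sum_empty, sub_zero]
      refine mul_pos (hc.lt_of_ne fun hc0 => hN ?_) hnM
      rw [hNeq, hSe, Finset.sum_empty, add_zero, ← hc0] at hν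
      simp only [map_zero, zero_mul, zero_add, eval_mul, eval_C, mul_eq_zero, hM, or_false] at hν
      rw [hNeq, hSe, hν, ← hc0]; simp
    · have := Finset.sum_neg hSle hSe
      nlinarith [mul_nonneg hc hnM.le]
  -- If `deg N ≥ deg M`, then `-M / N` has no linear part. Otherwise the polynomial part of `N / M`
  -- is zero and the sum of the residues, being negative, fixes the degree of `N` and the sign of
  -- its leading coefficient.
  all_goals
    rcases le_or_gt M.natDegree N.natDegree with hle | hlt
    · first
      | (rw [natDegree_neg]; omega)
      | (rw [coeff_neg, coeff_eq_zero_of_natDegree_lt (by omega)]; simp)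
    obtain ⟨rfl, rfl⟩ := hcd hlt
    have hcard : M.natDegree = S.card := h.natDegree_eq_card
    have hNd : N.degree < S.card := by
      rw [← hcard]; exact (degree_lt_degree hlt).trans_le degree_le_natDegree
    have hco := coeff_eq_sum_residues (v := id) Function.injective_id.injOn hk hNd
    rw [← hMeq, ← hcard] at hco
    have hSne : S.Nonempty := by rw [← Finset.card_pos]; omega
    have hneg : ∑ i ∈ S, eval (id i) N / eval (id i) (derivative M) < 0 := by
      refine Finset.sum_neg (fun μ hμ => ?_) hSne
      have hμ0 : M.eval μ = 0 := (mem_roots'.1 (Multiset.mem_toFinset.1 hμ)).2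
      exact div_neg_iff.2 (mul_neg_iff.1 (h.residue μ hμ0))
    have hne : N.coeff (M.natDegree - 1) ≠ 0 := by
      rw [hco]; exact mul_ne_zero hk hneg.ne
    have hdeg : N.natDegree = M.natDegree - 1 :=
      le_antisymm (by omega) (le_natDegree_of_ne_zero hne)
    have hpos : M.natDegree = N.natDegree + 1 := by omega
    first
    | (rw [natDegree_neg]; omega)
    | (rw [coeff_neg, ← hpos, leadingCoeff, hdeg, hco]
       change 0 ≤ -k * _
       nlinarith [sq_nonneg k])

theorem neg_neg (h : IsNevanlinna (-N) (-M)) : IsNevanlinna N M := by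
  refine ⟨neg_ne_zero.1 h.ne_zero, by simpa using h.splits.neg, fun μ hμ => ?_, ?_, ?_⟩
  · simpa using h.residue μ (by simpa using hμ)
  · simpa using h.natDegree_le
  · simpa using h.slope

theorem sub_affine (h : IsNevanlinna N M) {c : ℝ} (d : ℝ)
    (hc : 0 ≤ (N.coeff (M.natDegree + 1) - c * M.leadingCoeff) * M.leadingCoeff) :
    IsNevanlinna (N - (C c * X + C d) * M) M := by
  refine ⟨h.ne_zero, h.splits, fun μ hμ => ?_, ?_, ?_⟩
  · simpa [hμ] using h.residue μ hμ
  · refine (natDegree_sub_le _ _).trans (max_le h.natDegree_le ?_)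
    refine natDegree_mul_le.trans ?_
    have := natDegree_linear_le (a := c) (b := d)
    omega
  · have h1 : (C c * X + C d).coeff 1 = c := by simp
    rw [coeff_sub, add_comm M.natDegree 1,
      coeff_mul_add_eq_of_natDegree_le natDegree_linear_le le_rfl, add_comm 1, h1]
    exact hc

end IsNevanlinna

/-! ### Transfer across nodes -/

/-- A node `(x, ω({x}), v({x}))`. -/
abbrev Node := ℝ × ℝ × ℝ

section State

variable {A : Type*} [CommRing A] [Algebra ℝ A]

/-- The weight `z ω({x}) + z² v({x})`. -/
def Node.weight (z : A) (n : Node) : A := algebraMap ℝ A n.2.1 * z + algebraMap ℝ A n.2.2 * z ^ 2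

/-- The coefficients with respect to `exp (-x / 2)`, `exp (x / 2)` of a solution to the left of a
node in terms of those to the right. -/
noncomputable def cross (z : A) (n : Node) (c : A × A) : A × A :=
  (c.1 - n.weight z * (c.1 + algebraMap ℝ A (Real.exp n.1) * c.2),
    c.2 + algebraMap ℝ A (Real.exp (-n.1)) * (n.weight z *
      (c.1 + algebraMap ℝ A (Real.exp n.1) * c.2)))

/-- The coefficients of a solution to the left of a list of nodes. -/
noncomputable def state (z : A) (L : List Node) (c : A × A) : A × A := L.foldr (cross z) c

@[simp] theorem state_nil (z : A) (c : A × A) : state z [] c = c := rfl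

@[simp] theorem state_cons (z : A) (n : Node) (L : List Node) (c : A × A) :
    state z (n :: L) c = cross z n (state z L c) := rfl

theorem state_append (z : A) (L₁ L₂ : List Node) (c : A × A) :
    state z (L₁ ++ L₂) c = state z L₁ (state z L₂ c) := List.foldr_append

theorem map_state {B : Type*} [CommRing B] [Algebra ℝ B] (f : A →ₐ[ℝ] B) (z : A) (L : List Node)
    (c : A × A) : state (f z) L (f c.1, f c.2) = (f (state z L c).1, f (state z L c).2) := by
  induction L with
  | nil => rfl
  | cons n L ih =>
    rw [state_cons, state_cons, ih]
    simp [cross, Node.weight]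

end State

/-! ### Half-lines and the Stieltjes continued fraction -/

/-- Consecutive nodes to the right of `a`, with nonzero weights. -/
def IsAbove : ℝ → List Node → Prop
  | _, [] => True
  | a, n :: L => a < n.1 ∧ (n.2.1 ≠ 0 ∨ n.2.2 ≠ 0) ∧ 0 ≤ n.2.2 ∧ IsAbove n.1 L

/-- The polynomial `exp (a / 2) φ₊(·, a)`. -/
noncomputable def valuePoly (a : ℝ) (L : List Node) : ℝ[X] :=
  (state X L (1, 0)).1 + C (Real.exp a) * (state X L (1, 0)).2

/-- The coefficient of `exp (x / 2)` in `φ₊` to the left of `L`, divided by `X`. -/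
noncomputable def slopePoly (L : List Node) : ℝ[X] := (state (X : ℝ[X]) L (1, 0)).2.divX

theorem weight_X (n : Node) : n.weight (X : ℝ[X]) = X * (C n.2.1 + C n.2.2 * X) := by
  simp only [Node.weight, algebraMap_eq]; ring

theorem eval_zero_state (L : List Node) :
    (state (X : ℝ[X]) L (1, 0)).1.eval 0 = 1 ∧ (state (X : ℝ[X]) L (1, 0)).2.eval 0 = 0 := by
  induction L with
  | nil => simp
  | cons n L ih => simp [cross, weight_X, ih]

theorem X_mul_slopePoly (L : List Node) : X * slopePoly L = (state (X : ℝ[X]) L (1, 0)).2 := by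
  have := X_mul_divX_add (state (X : ℝ[X]) L (1, 0)).2
  rwa [coeff_zero_eq_eval_zero, (eval_zero_state L).2, C_0, add_zero] at this

@[simp] theorem valuePoly_nil (a : ℝ) : valuePoly a [] = 1 := by simp [valuePoly]

@[simp] theorem slopePoly_nil : slopePoly [] = 0 := by simp [slopePoly]

theorem eval_zero_valuePoly (a : ℝ) (L : List Node) : (valuePoly a L).eval 0 = 1 := by
  simp [valuePoly, eval_zero_state]

theorem valuePoly_ne_zero (a : ℝ) (L : List Node) : valuePoly a L ≠ 0 := fun h => by
  simpa [h] using eval_zero_valuePoly a L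

/-- Together with `valuePoly_cons` this is one step of a continued fraction: a node at `x` adds the
affine term `e^{-x} (ω + v z)` to `E / Y`, and the gap from `a` to `x` adds the linear term `(e^x -
e^a) z` to `-Y / E`. -/
theorem slopePoly_cons (n : Node) (L : List Node) :
    slopePoly (n :: L) = slopePoly L +
      C (Real.exp (-n.1)) * ((C n.2.1 + C n.2.2 * X) * valuePoly n.1 L) := by
  apply mul_left_cancel₀ (X_ne_zero (R := ℝ))
  rw [mul_add, X_mul_slopePoly, X_mul_slopePoly, state_cons, cross, weight_X, valuePoly,
    algebraMap_eq]
  ring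

theorem valuePoly_cons (a : ℝ) (n : Node) (L : List Node) :
    valuePoly a (n :: L) =
      valuePoly n.1 L - C (Real.exp n.1 - Real.exp a) * (X * slopePoly (n :: L)) := by
  have h : C (Real.exp n.1) * C (Real.exp (-n.1)) = (1 : ℝ[X]) := by
    rw [← C_mul, ← Real.exp_add]; simp
  rw [X_mul_slopePoly, valuePoly, valuePoly, state_cons, cross, algebraMap_eq, C_sub]
  linear_combination (n.weight X * ((state X L (1, 0)).1 + C (Real.exp n.1) * (state X L (1, 0)).2)) * h

theorem degree_valuePoly_le_of_degree_lt {n : Node} {L : List Node}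
    (hn : n.2.1 ≠ 0 ∨ n.2.2 ≠ 0) (h : (slopePoly L).degree < (valuePoly n.1 L).degree) :
    (valuePoly n.1 L).degree ≤ (slopePoly (n :: L)).degree := by
  rw [slopePoly_cons]
  have hA : C n.2.1 + C n.2.2 * X ≠ 0 := fun h0 => by
    have h1 := congrArg (coeff · 0) h0
    have h2 := congrArg (coeff · 1) h0
    simp at h1 h2
    tauto
  have h1 : (valuePoly n.1 L).degree ≤
      (C (Real.exp (-n.1)) * ((C n.2.1 + C n.2.2 * X) * valuePoly n.1 L)).degree := by
    rw [degree_C_mul (Real.exp_pos _).ne', mul_comm]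
    exact degree_le_mul_left _ hA
  rwa [degree_add_eq_right_of_degree_lt (h.trans_le h1)]

/-- A node with nonzero weight lifts the degree of `E` to at least that of `Y`, and the gap before
it then lifts `Y` to one above `E`. -/
theorem degree_slopePoly_lt {L : List Node} : ∀ {a : ℝ}, IsAbove a L →
    (slopePoly L).degree < (valuePoly a L).degree := by
  induction L with
  | nil => intro a _; simp
  | cons n L ih =>
    intro a ⟨han, hn, _, hL⟩
    have h1 := degree_valuePoly_le_of_degree_lt hn (ih hL)
    have hE : slopePoly (n :: L) ≠ 0 := fun h0 => by
      rw [h0, degree_zero, le_bot_iff, degree_eq_bot] at h1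
      exact valuePoly_ne_zero _ _ h1
    have h2 : (slopePoly (n :: L)).degree <
        (C (Real.exp n.1 - Real.exp a) * (X * slopePoly (n :: L))).degree := by
      rw [degree_C_mul (sub_ne_zero.2 (Real.exp_lt_exp.2 han).ne'), mul_comm, degree_mul_X]
      rw [degree_eq_natDegree hE]
      exact_mod_cast Nat.lt_succ_self _
    rw [valuePoly_cons, degree_sub_eq_right_of_degree_lt (h1.trans_lt h2)]
    exact h2

theorem X_mul_slopePoly_cons_add (a : ℝ) {n : Node} {L : List Node} (h : IsAbove a (n :: L)) :
    X * slopePoly (n :: L) + C (Real.exp n.1 - Real.exp a)⁻¹ * valuePoly a (n :: L) =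
      C (Real.exp n.1 - Real.exp a)⁻¹ * valuePoly n.1 L := by
  have h0 : Real.exp n.1 - Real.exp a ≠ 0 := (sub_pos.2 (Real.exp_lt_exp.2 h.1)).ne'
  have h1 : C (Real.exp n.1 - Real.exp a)⁻¹ * C (Real.exp n.1 - Real.exp a) = (1 : ℝ[X]) := by
    rw [← C_mul, inv_mul_cancel₀ h0, C_1]
  rw [valuePoly_cons]
  linear_combination (-(X * slopePoly (n :: L))) * h1

theorem degree_valuePoly_lt_cons {a : ℝ} {n : Node} {L : List Node} (h : IsAbove a (n :: L)) :
    (valuePoly n.1 L).degree < (valuePoly a (n :: L)).degree :=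
  (degree_valuePoly_le_of_degree_lt h.2.1 (degree_slopePoly_lt h.2.2.2)).trans_lt
    (degree_slopePoly_lt h)

/-- Here `k` is the limit of `-z E / Y` at infinity. It equals `1 / (e^x - e^a)` for the node `x`
nearest to `a`, and `0` without nodes. -/
theorem exists_degree_X_mul_slopePoly_add_lt {a : ℝ} {L : List Node} (h : IsAbove a L) :
    ∃ k : ℝ, 0 ≤ k ∧ (X * slopePoly L + C k * valuePoly a L).degree < (valuePoly a L).degree := by
  cases L with
  | nil => exact ⟨0, le_rfl, by simp⟩
  | cons n L =>
    refine ⟨(Real.exp n.1 - Real.exp a)⁻¹,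
      inv_nonneg.2 (sub_pos.2 (Real.exp_lt_exp.2 h.1)).le, ?_⟩
    rw [X_mul_slopePoly_cons_add a h]
    exact (degree_mul_le_of_le degree_C_le le_rfl).trans_lt
      (by rw [zero_add]; exact degree_valuePoly_lt_cons h)

theorem eq_of_degree_sub_lt {Y F : ℝ[X]} {k l : ℝ} (hk : (F + C k * Y).degree < Y.degree)
    (hl : (F + C l * Y).degree < Y.degree) : k = l := by
  by_contra hne
  have h1 : (F + C k * Y - (F + C l * Y)).degree < Y.degree :=
    (degree_sub_le _ _).trans_lt (max_lt hk hl)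
  have h2 : F + C k * Y - (F + C l * Y) = C (k - l) * Y := by rw [C_sub]; ring
  rw [h2, degree_C_mul (sub_ne_zero.2 hne)] at h1
  exact h1.false

/-- The continued fraction is read from the top: the limit of `-z E / Y` locates the nearest node,
which gives the value polynomial there, and the affine part of `E` divided by it gives the two
weights. -/
theorem list_ext_of_polys {L L' : List Node} {a : ℝ} (h : IsAbove a L) (h' : IsAbove a L')
    (hY : valuePoly a L = valuePoly a L') (hE : slopePoly L = slopePoly L') : L = L' := by
  induction L generalizing a L' with
  | nil =>
    cases L' with
    | nil => rfl
    | cons n L' =>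
      have := degree_valuePoly_lt_cons h'
      rw [← hY, valuePoly_nil, degree_one, ← not_le] at this
      exact absurd (zero_le_degree_iff.2 (valuePoly_ne_zero _ _)) this
  | cons n L ih =>
    cases L' with
    | nil =>
      have := degree_valuePoly_lt_cons h
      rw [hY, valuePoly_nil, degree_one, ← not_le] at this
      exact absurd (zero_le_degree_iff.2 (valuePoly_ne_zero _ _)) this
    | cons m L' =>
      have hk : (Real.exp n.1 - Real.exp a)⁻¹ = (Real.exp m.1 - Real.exp a)⁻¹ := by
        refine eq_of_degree_sub_lt (Y := valuePoly a (n :: L)) (F := X * slopePoly (n :: L)) ?_ ?_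
        · rw [X_mul_slopePoly_cons_add a h]
          exact (degree_mul_le_of_le degree_C_le le_rfl).trans_lt
            (by rw [zero_add]; exact degree_valuePoly_lt_cons h)
        · rw [hE, hY, X_mul_slopePoly_cons_add a h']
          exact (degree_mul_le_of_le degree_C_le le_rfl).trans_lt
            (by rw [zero_add]; exact degree_valuePoly_lt_cons h')
      have ht : n.1 = m.1 := by
        have := inv_injective hk
        exact Real.exp_injective (by linarith)
      have hY1 : valuePoly n.1 L = valuePoly n.1 L' := by
        have h1 := valuePoly_cons a n L
        have h2 := valuePoly_cons a m L'
        rw [← hE, ← hY, h1, ← ht] at h2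
        simpa using h2
      have h1 := slopePoly_cons n L
      have h2 := slopePoly_cons m L'
      rw [← hE, h1, ← ht, ← hY1] at h2
      have hdiff : C (Real.exp (-n.1)) * ((C (n.2.1 - m.2.1) + C (n.2.2 - m.2.2) * X) *
          valuePoly n.1 L) = slopePoly L' - slopePoly L := by
        rw [C_sub, C_sub]
        linear_combination h2
      have hA : C (n.2.1 - m.2.1) + C (n.2.2 - m.2.2) * X = (0 : ℝ[X]) := by
        by_contra hA
        have hle : (valuePoly n.1 L).degree ≤ (slopePoly L' - slopePoly L).degree := by
          rw [← hdiff, degree_C_mul (Real.exp_pos _).ne', mul_comm]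
          exact degree_le_mul_left _ hA
        refine absurd ((degree_sub_le _ _).trans_lt (max_lt ?_ (degree_slopePoly_lt h.2.2.2))) hle.not_gt
        rw [hY1]
        exact degree_slopePoly_lt (by rw [ht]; exact h'.2.2.2)
      have hw : n.2.1 = m.2.1 := by
        have := congrArg (coeff · 0) hA
        simp at this
        linarith
      have hu : n.2.2 = m.2.2 := by
        have := congrArg (coeff · 1) hA
        simp at this
        linarith
      rw [hA, zero_mul, mul_zero] at hdiff
      rw [ih h.2.2.2 (by rw [ht]; exact h'.2.2.2) hY1 (sub_eq_zero.1 hdiff.symm).symm,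
        show n = m from Prod.ext ht (Prod.ext hw hu)]

/-- Induction on `deg Y`, alternating the passage to the negative inverse with the removal of the
affine part; both preserve the Herglotz property, which supplies the positive gaps and the
nonnegative `v`-weights. -/
theorem exists_list_of_isNevanlinna {Y E : ℝ[X]} (a : ℝ) (h : IsNevanlinna E Y)
    (hdeg : E.degree < Y.degree) (h0 : Y.eval 0 = 1) :
    ∃ L, IsAbove a L ∧ valuePoly a L = Y ∧ slopePoly L = E := by
  induction hn : Y.natDegree using Nat.strong_induction_on generalizing a Y E with
  | _ m ih =>
  rcases Nat.eq_zero_or_pos m with rfl | hm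
  · rw [eq_C_of_natDegree_eq_zero hn] at h0 hdeg ⊢
    rw [eval_C] at h0
    rw [h0, C_1, degree_one] at hdeg
    refine ⟨[], trivial, by rw [valuePoly_nil, h0, C_1], ?_⟩
    rw [slopePoly_nil]
    by_contra hE
    exact absurd (zero_le_degree_iff.2 (Ne.symm hE)) hdeg.not_ge
  · have hE : E ≠ 0 := by
      rintro rfl
      obtain ⟨μ, hμ⟩ := h.splits.exists_eval_eq_zero (by
        rw [degree_eq_natDegree h.ne_zero, hn]; exact_mod_cast hm.ne')
      simpa using h.residue μ hμ
    have hinv := h.neg_inv hE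
    have hdeg' : E.natDegree < Y.natDegree := natDegree_lt_natDegree hE hdeg
    have hYd : Y.natDegree = E.natDegree + 1 := by
      have := hinv.natDegree_le
      rw [natDegree_neg] at this
      omega
    have hs := hinv.slope
    rw [coeff_neg, ← hYd, coeff_natDegree] at hs
    have hlE := leadingCoeff_ne_zero.2 hE
    have hlY := leadingCoeff_ne_zero.2 h.ne_zero
    -- The slope of `-Y / E` at infinity, which has to be the gap `e^t - e^a` to the next node `t`.
    set l := -Y.leadingCoeff / E.leadingCoeff with hl
    have hlpos : 0 < l := by
      have h1 : l = -Y.leadingCoeff * E.leadingCoeff / E.leadingCoeff ^ 2 := by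
        rw [hl]; field_simp
      have h2 : 0 < -Y.leadingCoeff * E.leadingCoeff :=
        hs.lt_of_ne (mul_ne_zero (neg_ne_zero.2 hlY) hlE).symm
      rw [h1]; positivity
    set Y₁ := Y + C l * (X * E) with hY₁
    have hsub : -Y - (C l * X + C 0) * E = -Y₁ := by rw [hY₁, C_0]; ring
    have hlE' : l * E.leadingCoeff = -Y.leadingCoeff := div_mul_cancel₀ _ hlE
    have hN1 : IsNevanlinna (-Y₁) E := by
      rw [← hsub]
      refine hinv.sub_affine 0 ?_
      rw [coeff_neg, ← hYd, coeff_natDegree, hlE']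
      simp
    have h10 : Y₁.eval 0 = 1 := by simp [hY₁, h0]
    have hY10 : Y₁ ≠ 0 := fun h1 => by simp [h1] at h10
    have hN2 : IsNevanlinna E Y₁ := (hN1.neg_inv (neg_ne_zero.2 hY10)).neg_neg
    have hd1 : Y₁.natDegree ≤ E.natDegree := by
      refine natDegree_le_iff_coeff_eq_zero.2 fun j hj => ?_
      rw [hY₁, coeff_add, coeff_C_mul]
      rcases Nat.lt_or_eq_of_le (Nat.succ_le_of_lt hj) with hj' | rfl
      · rw [coeff_eq_zero_of_natDegree_lt (by omega), coeff_eq_zero_of_natDegree_lt, mul_zero,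
          add_zero]
        rw [mul_comm, natDegree_mul_X hE]; omega
      · rw [Nat.succ_eq_add_one, coeff_X_mul, ← hYd, coeff_natDegree, coeff_natDegree, hlE']
        ring
    obtain ⟨c, d, hc, hq, hcoef⟩ := hN2.exists_div_eq_affine
    have hmod : E - (C c * X + C d) * Y₁ = E % Y₁ := by
      rw [← hq]
      linear_combination -(EuclideanDomain.div_add_mod E Y₁)
    have hN3 : IsNevanlinna (E % Y₁) Y₁ := by
      rw [← hmod]
      refine hN2.sub_affine d ?_
      rw [hcoef]
      simp [mul_comm]
    -- With a vanishing affine part `deg E < deg Y₁`, against `hd1`; hence the new node carries a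
    -- nonzero weight.
    have hcd : d ≠ 0 ∨ c ≠ 0 := by
      by_contra hcon
      rw [not_or, not_not, not_not] at hcon
      rw [hcon.1, hcon.2, C_0, zero_mul, zero_add, Polynomial.div_eq_zero_iff hY10] at hq
      exact absurd (natDegree_lt_natDegree hE hq) (by omega)
    have hpos : 0 < Real.exp a + l := by positivity
    set t := Real.log (Real.exp a + l) with ht
    have het : Real.exp t = Real.exp a + l := Real.exp_log hpos
    obtain ⟨L, hL, hLY, hLE⟩ := ih Y₁.natDegree (by omega) t hN3
      (EuclideanDomain.mod_lt E hY10) h10 rfl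
    have hee : C (Real.exp (-t)) * C (Real.exp t) = (1 : ℝ[X]) := by
      rw [← C_mul, ← Real.exp_add]; simp
    have hEL : slopePoly ((t, Real.exp t * d, Real.exp t * c) :: L) = E := by
      rw [slopePoly_cons]
      simp only [hLY, hLE, C_mul]
      rw [← hmod]
      linear_combination ((C d + C c * X) * Y₁) * hee
    refine ⟨(t, Real.exp t * d, Real.exp t * c) :: L, ⟨?_, ?_, ?_, hL⟩, ?_, hEL⟩
    · rw [← Real.exp_lt_exp]
      change _ < Real.exp t
      linarith
    · simpa [Real.exp_ne_zero] using hcd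
    · exact mul_nonneg (Real.exp_pos _).le hc
    · rw [valuePoly_cons, hEL]
      simp only [hLY]
      rw [het, hY₁, add_sub_cancel_left]
      ring

/-! ### Reflection and Wronskians -/

section Reflection

variable {A : Type*} [CommRing A] [Algebra ℝ A]

/-- The reflected list of nodes. -/
def reflect (L : List Node) : List Node := (L.map fun n => (-n.1, n.2)).reverse

@[simp] theorem reflect_nil : reflect [] = [] := rfl

theorem reflect_append_singleton (L : List Node) (n : Node) :
    reflect (L ++ [n]) = (-n.1, n.2) :: reflect L := by
  simp [reflect]

@[simp] theorem reflect_reflect (L : List Node) : reflect (reflect L) = L := by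
  simp [reflect, Function.comp_def]

theorem algebraMap_exp_mul_exp_neg (t : ℝ) :
    algebraMap ℝ A (Real.exp t) * algebraMap ℝ A (Real.exp (-t)) = 1 := by
  rw [← map_mul, ← Real.exp_add]; simp

theorem cross_smul (z : A) (n : Node) (k : A) (c : A × A) : cross z n (k • c) = k • cross z n c := by
  ext <;> simp only [cross, Prod.smul_fst, Prod.smul_snd, smul_eq_mul] <;> ring

theorem state_smul (z : A) (L : List Node) (k : A) (c : A × A) :
    state z L (k • c) = k • state z L c := by
  induction L with
  | nil => rfl
  | cons n L ih => rw [state_cons, state_cons, ih, cross_smul]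

theorem cross_injective (z : A) (n : Node) : Function.Injective (cross z n) := by
  have : Function.LeftInverse
      (fun c : A × A => (c.1 + n.weight z * (c.1 + algebraMap ℝ A (Real.exp n.1) * c.2),
        c.2 - algebraMap ℝ A (Real.exp (-n.1)) * (n.weight z *
          (c.1 + algebraMap ℝ A (Real.exp n.1) * c.2)))) (cross z n) := by
    intro c
    have h := algebraMap_exp_mul_exp_neg (A := A) n.1
    ext
    · simp only [cross]
      linear_combination (n.weight z * n.weight z *
        (c.1 + algebraMap ℝ A (Real.exp n.1) * c.2)) * h
    · simp only [cross]
      linear_combination (-(n.weight z * n.weight z * algebraMap ℝ A (Real.exp (-n.1)) *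
        (c.1 + algebraMap ℝ A (Real.exp n.1) * c.2))) * h
  exact this.injective

theorem cross_value (z : A) (n : Node) (c : A × A) :
    (cross z n c).1 + algebraMap ℝ A (Real.exp n.1) * (cross z n c).2 =
      c.1 + algebraMap ℝ A (Real.exp n.1) * c.2 := by
  simp only [cross]
  linear_combination (n.weight z * (c.1 + algebraMap ℝ A (Real.exp n.1) * c.2)) *
    algebraMap_exp_mul_exp_neg (A := A) n.1

theorem cross_swap_cross (z : A) (n : Node) (c : A × A) :
    cross z n (cross z (-n.1, n.2) c).swap = c.swap := by
  have h := algebraMap_exp_mul_exp_neg (A := A) n.1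
  have hw : Node.weight z ((-n.1, n.2) : Node) = n.weight z := rfl
  ext
  · simp only [cross, hw, neg_neg, Prod.fst_swap, Prod.snd_swap]
    linear_combination (n.weight z * c.2) * h
  · simp only [cross, hw, neg_neg, Prod.fst_swap, Prod.snd_swap]
    linear_combination (n.weight z * c.1) * h

/-- To the left of `L`, the reflected solution becomes `exp (x / 2)`. -/
theorem state_swap_state_reflect (z : A) (L : List Node) :
    state z L (state z (reflect L) (1, 0)).swap = (0, 1) := by
  induction L using List.reverseRecOn with
  | nil => rfl
  | append_singleton L n ih =>
    rw [reflect_append_singleton, state_append, state_cons, state_cons, state_nil,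
      cross_swap_cross, ih]

theorem wronskian_cross (z : A) (n : Node) (c d : A × A) :
    (cross z n c).1 * (cross z n d).2 - (cross z n c).2 * (cross z n d).1 =
      c.1 * d.2 - c.2 * d.1 := by
  simp only [cross]
  linear_combination (n.weight z * (c.1 * d.2 - c.2 * d.1)) *
    algebraMap_exp_mul_exp_neg (A := A) n.1

theorem wronskian_state (z : A) (L : List Node) (c d : A × A) :
    (state z L c).1 * (state z L d).2 - (state z L c).2 * (state z L d).1 =
      c.1 * d.2 - c.2 * d.1 := by
  induction L with
  | nil => rfl
  | cons n L ih => rw [state_cons, state_cons, wronskian_cross, ih]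

theorem state_injective (z : A) (L : List Node) : Function.Injective (state z L) := by
  induction L with
  | nil => exact fun _ _ h => h
  | cons n L ih => exact (cross_injective z n).comp ih

/-- The Wronskian with the solution decaying at `-∞` is constant across nodes, and to the left of
`L` it is exactly the coefficient of `exp (-x / 2)`. -/
theorem fst_state (z : A) (L : List Node) (c : A × A) :
    (state z L c).1 = c.1 * (state z (reflect L) (1, 0)).1 - c.2 * (state z (reflect L) (1, 0)).2 := by
  have := wronskian_state z L c (state z (reflect L) (1, 0)).swap
  rw [state_swap_state_reflect] at this
  simpa using this

theorem eq_smul_of_fst_state_eq_zero (z : A) (L : List Node) (c : A × A)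
    (h : (state z L c).1 = 0) : c = (state z L c).2 • (state z (reflect L) (1, 0)).swap := by
  apply state_injective z L
  rw [state_smul, state_swap_state_reflect]
  ext <;> simp [h]

end Reflection

/-! ### The Wronski polynomial and the norming constants -/

/-- The Wronski polynomial, whose zeros are the eigenvalues. -/
noncomputable def wronskiPoly (L : List Node) : ℝ[X] := (state X L (1, 0)).1

theorem eval_zero_wronskiPoly (L : List Node) : (wronskiPoly L).eval 0 = 1 := (eval_zero_state L).1

/-- The Wronskian may be computed at any point, here at the node `n`, from the decaying solutions of
the two half-lines. -/
theorem wronskiPoly_split (L₁ L₂ : List Node) (n : Node) :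
    wronskiPoly (L₁ ++ n :: L₂) =
      (1 - n.weight X) * (valuePoly n.1 L₂ * valuePoly (-n.1) (reflect L₁)) -
        X * (C (Real.exp n.1) * slopePoly L₂) * valuePoly (-n.1) (reflect L₁) -
        X * (C (Real.exp (-n.1)) * slopePoly (reflect L₁)) * valuePoly n.1 L₂ := by
  have h := algebraMap_exp_mul_exp_neg (A := ℝ[X]) n.1
  rw [wronskiPoly, state_append, fst_state, state_cons, mul_left_comm X, mul_left_comm X,
    X_mul_slopePoly, X_mul_slopePoly]
  simp only [cross, valuePoly]
  rw [algebraMap_eq] at h ⊢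
  linear_combination ((1 : ℝ[X]) * (state X L₂ (1, 0)).2 * (state X (reflect L₁) (1, 0)).2) * h

/-- The polynomial `γ² = ∫ φ₊² dω + 2 z ∫ φ₊² dv`. -/
noncomputable def gammaPoly : List Node → ℝ[X]
  | [] => 0
  | n :: L => C (Real.exp (-n.1)) * (C n.2.1 + C (2 * n.2.2) * X) * valuePoly n.1 L ^ 2 + gammaPoly L

/-- Lagrange identity in the spectral parameter: each node contributes the `z`-derivative of its
weight times `φ₊²`. At an eigenvalue it becomes `γ² = -b W'`, where `b` is the coefficient of `exp
(x / 2)` on the far left. -/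
theorem wronskian_derivative_state (L : List Node) :
    (state (X : ℝ[X]) L (1, 0)).1 * derivative (state (X : ℝ[X]) L (1, 0)).2 -
      (state (X : ℝ[X]) L (1, 0)).2 * derivative (state (X : ℝ[X]) L (1, 0)).1 = gammaPoly L := by
  induction L with
  | nil => simp [gammaPoly]
  | cons n L ih =>
    have h := algebraMap_exp_mul_exp_neg (A := ℝ[X]) n.1
    have hw : derivative (n.weight (X : ℝ[X])) = C n.2.1 + C (2 * n.2.2) * X := by
      rw [weight_X, two_mul, C_add]
      simp
      ring
    rw [gammaPoly, ← ih, ← hw, state_cons]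
    simp only [cross, valuePoly, derivative_sub, derivative_add, derivative_mul, algebraMap_eq,
      derivative_C, zero_mul, zero_add] at h ⊢
    generalize (state (X : ℝ[X]) L (1, 0)).1 = a at *
    generalize (state (X : ℝ[X]) L (1, 0)).2 = b at *
    generalize n.weight (X : ℝ[X]) = q at *
    linear_combination (q * (a * derivative b - b * derivative a) -
      b * derivative q * (a + C (Real.exp n.1) * b)) * h

/-- At an eigenvalue `φ₊` is `b` times the solution decaying at `-∞`, and `γ² = -b W'`; eliminate
`b`. Only the states of the two lists are compared, so that the splitting point may carry no mass.
-/
theorem valuePoly_mul_gammaPoly {L L₁ L₂ : List Node} {n : Node}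
    (hL : state (X : ℝ[X]) L (1, 0) = state X (L₁ ++ n :: L₂) (1, 0)) {lam : ℝ}
    (h : (wronskiPoly L).eval lam = 0) :
    (valuePoly n.1 L₂ * valuePoly (-n.1) (reflect L₁)).eval lam * (gammaPoly L).eval lam =
      -(derivative (wronskiPoly L)).eval lam *
        (Real.exp (-n.1) * (valuePoly n.1 L₂).eval lam ^ 2) := by
  have hev : ∀ L : List Node, state lam L ((1 : ℝ), (0 : ℝ)) =
      ((state (X : ℝ[X]) L (1, 0)).1.eval lam, (state (X : ℝ[X]) L (1, 0)).2.eval lam) := fun L => by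
    have := map_state (aeval lam : ℝ[X] →ₐ[ℝ] ℝ) X L (1, 0)
    simpa [aeval_def] using this
  have hg : (gammaPoly L).eval lam =
      -(state (X : ℝ[X]) L (1, 0)).2.eval lam * (derivative (wronskiPoly L)).eval lam := by
    have h' : eval lam (state (X : ℝ[X]) L (1, 0)).1 = 0 := h
    rw [← wronskian_derivative_state]
    simp only [eval_sub, eval_mul, h', wronskiPoly]
    ring
  have h1 := eq_smul_of_fst_state_eq_zero lam L₁ (state lam (n :: L₂) (1, 0)) (by
    rw [← state_append, hev, ← hL]; exact h)
  rw [← state_append, hev (L₁ ++ n :: L₂), ← hL, state_cons, hev, hev] at h1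
  have h2 := cross_value lam n
    (eval lam (state (X : ℝ[X]) L₂ (1, 0)).1, eval lam (state (X : ℝ[X]) L₂ (1, 0)).2)
  rw [h1] at h2
  simp only [Prod.smul_fst, Prod.smul_snd, Prod.swap, smul_eq_mul, Algebra.algebraMap_self,
    RingHom.id_apply] at h2
  have h3 : (valuePoly n.1 L₂).eval lam = (state (X : ℝ[X]) L (1, 0)).2.eval lam *
      (Real.exp n.1 * (valuePoly (-n.1) (reflect L₁)).eval lam) := by
    have he : Real.exp n.1 * Real.exp (-n.1) = 1 := by rw [← Real.exp_add]; simp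
    simp only [valuePoly, eval_add, eval_mul, eval_C]
    rw [← h2]
    linear_combination (-(state (X : ℝ[X]) L (1, 0)).2.eval lam *
      eval lam (state (X : ℝ[X]) (reflect L₁) (1, 0)).2) * he
  have he : Real.exp n.1 * Real.exp (-n.1) = 1 := by rw [← Real.exp_add]; simp
  rw [hg, eval_mul, sq]
  nth_rw 3 [h3]
  linear_combination (eval lam (valuePoly n.1 L₂) * eval lam (valuePoly (-n.1) (reflect L₁)) *
    eval lam (state (X : ℝ[X]) L (1, 0)).2 * eval lam (derivative (wronskiPoly L))) * he

/-! ### Solutions of the differential equation -/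

/-- The solution `c.1 exp (-x / 2) + c.2 exp (x / 2)` of the free equation. -/
noncomputable def free (c : ℂ × ℂ) (x : ℝ) : ℂ :=
  (Real.exp (-x / 2) : ℂ) * c.1 + (Real.exp (x / 2) : ℂ) * c.2

/-- The coefficients of the derivative of a free solution. -/
noncomputable def diffCoeff (c : ℂ × ℂ) : ℂ × ℂ := (-c.1 / 2, c.2 / 2)

theorem hasDerivAt_free (c : ℂ × ℂ) (x : ℝ) : HasDerivAt (free c) (free (diffCoeff c) x) x := by
  have h1 : HasDerivAt (fun x : ℝ => ((Real.exp (-x / 2) : ℝ) : ℂ))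
      ((Real.exp (-x / 2) * (-1 / 2) : ℝ) : ℂ) x :=
    (((hasDerivAt_id x).neg.div_const 2).exp).ofReal_comp
  have h2 : HasDerivAt (fun x : ℝ => ((Real.exp (x / 2) : ℝ) : ℂ))
      ((Real.exp (x / 2) * (1 / 2) : ℝ) : ℂ) x :=
    (((hasDerivAt_id x).div_const 2).exp).ofReal_comp
  refine ((h1.mul_const c.1).add (h2.mul_const c.2)).congr_deriv ?_
  simp only [free, diffCoeff]
  push_cast
  ring

theorem deriv_free (c : ℂ × ℂ) : deriv (free c) = free (diffCoeff c) :=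
  funext fun x => (hasDerivAt_free c x).deriv

theorem continuous_free (c : ℂ × ℂ) : Continuous (free c) :=
  continuous_iff_continuousAt.2 fun x => (hasDerivAt_free c x).continuousAt

theorem free_injective {c d : ℂ × ℂ} {x : ℝ} (h : free c x = free d x)
    (h' : free (diffCoeff c) x = free (diffCoeff d) x) : c = d := by
  simp only [free, diffCoeff] at h h'
  have h1 : ((Real.exp (-x / 2) : ℝ) : ℂ) ≠ 0 := by exact_mod_cast (Real.exp_pos _).ne'
  have h2 : ((Real.exp (x / 2) : ℝ) : ℂ) ≠ 0 := by exact_mod_cast (Real.exp_pos _).ne'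
  ext
  · apply mul_left_cancel₀ h1
    linear_combination (1 / 2) * h - h'
  · apply mul_left_cancel₀ h2
    linear_combination (1 / 2) * h + h'

theorem free_cross (z : ℂ) (n : Node) (c : ℂ × ℂ) : free (cross z n c) n.1 = free c n.1 := by
  have h := cross_value z n c
  have he : Real.exp (n.1 / 2) = Real.exp (-n.1 / 2) * Real.exp n.1 := by
    rw [← Real.exp_add]; ring_nf
  simp only [free, he]
  push_cast
  simp only [Complex.coe_algebraMap, Complex.ofReal_exp] at h ⊢
  linear_combination Complex.exp (-n.1 / 2) * h

theorem free_diffCoeff_cross (z : ℂ) (n : Node) (c : ℂ × ℂ) :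
    free (diffCoeff (cross z n c)) n.1 = free (diffCoeff c) n.1 + n.weight z * free c n.1 := by
  have he : Real.exp (n.1 / 2) = Real.exp (-n.1 / 2) * Real.exp n.1 := by
    rw [← Real.exp_add]; ring_nf
  have h := algebraMap_exp_mul_exp_neg (A := ℂ) n.1
  simp only [free, diffCoeff, cross, he]
  simp only [Complex.coe_algebraMap] at h ⊢
  push_cast at h ⊢
  linear_combination ((1 / 2 : ℂ) * n.weight z * Complex.exp (-n.1 / 2) *
    (c.1 + Complex.exp n.1 * c.2)) * h

/-- The coefficients are `e^{x/2} (f/2 - f')` and `e^{-x/2} (f/2 + f')`, whose derivatives vanish by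
the equation. -/
theorem IsSolution.exists_free {ω : ℝ →₀ ℝ} {v : ℝ →₀ ℝ≥0} {z : ℂ} {f : ℝ → ℂ}
    (hf : IsSolution ω v z f) {S : Set ℝ} (hS : IsOpen S) (hS' : IsPreconnected S)
    (hn : ∀ x ∈ S, ¬ IsNode ω v x) : ∃ c, ∀ x ∈ S, f x = free c x := by
  have hd1 : ∀ x ∈ S, HasDerivAt f (deriv f x) x := fun x hx =>
    (hf.differentiableAt x (hn x hx)).hasDerivAt
  have hd2 : ∀ x ∈ S, HasDerivAt (deriv f) (f x / 4) x := fun x hx => by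
    obtain ⟨f₂, h1, h2⟩ := hf.equation x (hn x hx)
    rwa [show f x / 4 = f₂ by linear_combination h2]
  have h1 : ∀ x : ℝ, HasDerivAt (fun x : ℝ => ((Real.exp (-x / 2) : ℝ) : ℂ))
      ((Real.exp (-x / 2) * (-1 / 2) : ℝ) : ℂ) x :=
    fun x => (((hasDerivAt_id x).neg.div_const 2).exp).ofReal_comp
  have h2 : ∀ x : ℝ, HasDerivAt (fun x : ℝ => ((Real.exp (x / 2) : ℝ) : ℂ))
      ((Real.exp (x / 2) * (1 / 2) : ℝ) : ℂ) x :=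
    fun x => (((hasDerivAt_id x).div_const 2).exp).ofReal_comp
  have hA : ∀ x ∈ S, HasDerivAt (fun x => (Real.exp (x / 2) : ℂ) * (f x / 2 - deriv f x)) 0 x :=
    fun x hx => by
      refine ((h2 x).mul (((hd1 x hx).div_const 2).sub (hd2 x hx))).congr_deriv ?_
      push_cast
      simp only [Pi.sub_apply]
      ring
  have hB : ∀ x ∈ S, HasDerivAt (fun x => (Real.exp (-x / 2) : ℂ) * (f x / 2 + deriv f x)) 0 x :=
    fun x hx => by
      refine ((h1 x).mul (((hd1 x hx).div_const 2).add (hd2 x hx))).congr_deriv ?_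
      push_cast
      simp only [Pi.add_apply]
      ring
  obtain ⟨a, ha⟩ := hS.exists_is_const_of_deriv_eq_zero hS'
    (fun x hx => (hA x hx).differentiableAt.differentiableWithinAt) (fun x hx => (hA x hx).deriv)
  obtain ⟨b, hb⟩ := hS.exists_is_const_of_deriv_eq_zero hS'
    (fun x hx => (hB x hx).differentiableAt.differentiableWithinAt) (fun x hx => (hB x hx).deriv)
  refine ⟨(a, b), fun x hx => ?_⟩
  have he : ((Real.exp (x / 2) : ℝ) : ℂ) * (Real.exp (-x / 2) : ℝ) = 1 := by
    rw [← Complex.ofReal_mul, ← Real.exp_add]; ring_nf; simp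
  simp only [free, ← ha x hx, ← hb x hx]
  linear_combination (-f x) * he

/-! ### Measures as sorted lists of nodes -/

/-- `L` lists the nodes of `(ω, v)` in increasing order. -/
structure Represents (L : List Node) (ω : ℝ →₀ ℝ) (v : ℝ →₀ ℝ≥0) : Prop where
  sorted : L.Pairwise fun m n => m.1 < n.1
  mem_iff : ∀ n : Node, n ∈ L ↔ IsNode ω v n.1 ∧ n.2.1 = ω n.1 ∧ n.2.2 = v n.1

/-- The nodes to the right of `x`. -/
noncomputable def above (x : ℝ) (L : List Node) : List Node := L.filter fun n => x < n.1

theorem above_eventuallyEq_right (x : ℝ) (L : List Node) :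
    ∀ᶠ y in 𝓝[≥] x, above y L = above x L := by
  induction L with
  | nil => simp [above]
  | cons n L ih =>
    have hn : ∀ᶠ y in 𝓝[≥] x, (y < n.1 ↔ x < n.1) := by
      rcases lt_or_ge x n.1 with h | h
      · filter_upwards [nhdsWithin_le_nhds (Iio_mem_nhds h)] with y hy
        exact ⟨fun _ => h, fun _ => hy⟩
      · filter_upwards [self_mem_nhdsWithin] with y hy
        exact ⟨fun h' => absurd (h.trans hy) h'.not_ge, fun h' => absurd h h'.not_ge⟩
    filter_upwards [ih, hn] with y hy hny
    simp only [above, List.filter_cons, decide_eq_true_eq, hny] at hy ⊢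
    rw [hy]

theorem above_eventuallyEq_left (x : ℝ) (L : List Node) :
    ∀ᶠ y in 𝓝[<] x, above y L = L.filter fun n => x ≤ n.1 := by
  induction L with
  | nil => simp [above]
  | cons n L ih =>
    have hn : ∀ᶠ y in 𝓝[<] x, (y < n.1 ↔ x ≤ n.1) := by
      rcases le_or_gt x n.1 with h | h
      · filter_upwards [self_mem_nhdsWithin] with y hy
        exact ⟨fun _ => h, fun _ => (hy : y < x).trans_le h⟩
      · filter_upwards [nhdsWithin_le_nhds (Ioi_mem_nhds h)] with y hy
        exact ⟨fun h' => absurd (h'.trans hy) (lt_irrefl _), fun h' => absurd h h'.not_gt⟩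
    filter_upwards [ih, hn] with y hy hny
    simp only [above, List.filter_cons, decide_eq_true_eq, hny] at hy ⊢
    rw [hy]

theorem filter_le_eq_append {L : List Node} (hL : L.Pairwise fun m n => m.1 < n.1) (x : ℝ) :
    (L.filter fun n => x ≤ n.1) = (L.filter fun n => n.1 = x) ++ above x L := by
  induction L with
  | nil => rfl
  | cons n L ih =>
    have ih := ih (List.pairwise_cons.1 hL).2
    have hlt := (List.pairwise_cons.1 hL).1
    rcases lt_trichotomy n.1 x with h | h | h
    · simpa [above, List.filter_cons, h.not_ge, h.ne, h.not_gt] using ih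
    · simpa [above, List.filter_cons, h] using ih
    · have h0 : (L.filter fun n => n.1 = x) = [] := by
        rw [List.filter_eq_nil_iff]
        intro m hm
        simpa using (h.trans (hlt m hm)).ne'
      simp only [above] at ih ⊢
      rw [h0, List.nil_append] at ih
      simp [h.le, h.ne', h, h0, ih]

namespace Represents

variable {L : List Node} {ω : ℝ →₀ ℝ} {v : ℝ →₀ ℝ≥0}

theorem filter_eq_cases (h : Represents L ω v) (x : ℝ) :
    (IsNode ω v x ∧ (L.filter fun n => n.1 = x) = [(x, ω x, (v x : ℝ))]) ∨
      (¬ IsNode ω v x ∧ (L.filter fun n => n.1 = x) = []) := by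
  have hmem : ∀ n ∈ (L.filter fun n => n.1 = x), IsNode ω v x ∧ n = (x, ω x, (v x : ℝ)) := by
    intro n hn
    simp only [List.mem_filter, decide_eq_true_eq] at hn
    obtain ⟨hn, rfl⟩ := hn
    obtain ⟨h1, h2, h3⟩ := (h.mem_iff n).1 hn
    exact ⟨h1, Prod.ext rfl (Prod.ext h2 h3)⟩
  have hs := h.sorted.filter fun n => n.1 = x
  by_cases hx : IsNode ω v x
  · refine Or.inl ⟨hx, ?_⟩
    have hin : ((x, ω x, (v x : ℝ)) : Node) ∈ L.filter fun n => n.1 = x := by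
      simp only [List.mem_filter, decide_eq_true_eq, and_true]
      exact (h.mem_iff _).2 ⟨hx, rfl, rfl⟩
    match hl : L.filter fun n => n.1 = x with
    | [] => rw [hl] at hin; simp at hin
    | [m] => rw [hl, (hmem m (by rw [hl]; simp)).2]
    | m :: m' :: l =>
      rw [hl] at hs
      have h1 := (List.pairwise_cons.1 hs).1 m' (by simp)
      rw [(hmem m (by rw [hl]; simp)).2, (hmem m' (by rw [hl]; simp)).2] at h1
      exact absurd h1 (lt_irrefl _)
  · refine Or.inr ⟨hx, List.eq_nil_iff_forall_not_mem.2 fun n hn => hx (hmem n hn).1⟩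

/-- Crossing a point without mass is the identity, so nodes and other points need no separate
treatment. -/
theorem state_filter_eq {A : Type*} [CommRing A] [Algebra ℝ A] (h : Represents L ω v) (x : ℝ)
    (z : A) (c : A × A) :
    state z (L.filter fun n => n.1 = x) c = cross z (x, ω x, (v x : ℝ)) c := by
  rcases h.filter_eq_cases x with ⟨-, h1⟩ | ⟨h0, h1⟩
  · rw [h1]; rfl
  · rw [h1]
    simp only [IsNode, not_or, not_not] at h0
    simp [cross, Node.weight, h0.1, h0.2]

end Represents

/-- The solution which equals `c.1 exp (-x / 2) + c.2 exp (x / 2)` to the right of all nodes. -/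
noncomputable def sol (z : ℂ) (L : List Node) (c : ℂ × ℂ) (x : ℝ) : ℂ :=
  free (state z (above x L) c) x

theorem eventually_nhds_of_nhdsGT {p : ℝ → Prop} {x : ℝ} (h : ∀ᶠ y in 𝓝[>] x, p y) :
    ∀ᶠ y in 𝓝[>] x, ∀ᶠ w in 𝓝 y, p w := by
  filter_upwards [eventually_eventually_nhdsWithin.2 h, self_mem_nhdsWithin] with y hy hxy
  rwa [IsOpen.nhdsWithin_eq isOpen_Ioi hxy] at hy

theorem eventually_nhds_of_nhdsLT {p : ℝ → Prop} {x : ℝ} (h : ∀ᶠ y in 𝓝[<] x, p y) :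
    ∀ᶠ y in 𝓝[<] x, ∀ᶠ w in 𝓝 y, p w := by
  filter_upwards [eventually_eventually_nhdsWithin.2 h, self_mem_nhdsWithin] with y hy hxy
  rwa [IsOpen.nhdsWithin_eq isOpen_Iio hxy] at hy

theorem tendsto_deriv_of_eventuallyEq_free {f : ℝ → ℂ} {l : Filter ℝ} {x : ℝ} {c : ℂ × ℂ}
    (hl : l ≤ 𝓝 x)
    (h : ∀ᶠ y in l, f =ᶠ[𝓝 y] free c) : Tendsto (deriv f) l (𝓝 (free (diffCoeff c) x)) := by
  refine Tendsto.congr' ?_ (((continuous_free (diffCoeff c)).tendsto x).mono_left hl)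
  filter_upwards [h] with y hy
  rw [hy.deriv_eq, deriv_free]

section Sol

variable {L : List Node} {ω : ℝ →₀ ℝ} {v : ℝ →₀ ℝ≥0}

theorem sol_right (z : ℂ) (L : List Node) (c : ℂ × ℂ) (x : ℝ) :
    ∀ᶠ y in 𝓝[≥] x, sol z L c y = free (state z (above x L) c) y := by
  filter_upwards [above_eventuallyEq_right x L] with y hy
  rw [sol, hy]

theorem Represents.sol_left (h : Represents L ω v) (z : ℂ) (c : ℂ × ℂ) (x : ℝ) :
    ∀ᶠ y in 𝓝[<] x, sol z L c y =
      free (cross z (x, ω x, (v x : ℝ)) (state z (above x L) c)) y := by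
  filter_upwards [above_eventuallyEq_left x L] with y hy
  rw [sol, hy, filter_le_eq_append h.sorted, state_append, h.state_filter_eq]

theorem Represents.sol_nhds (h : Represents L ω v) (z : ℂ) (c : ℂ × ℂ) {x : ℝ}
    (hx : ¬ IsNode ω v x) : sol z L c =ᶠ[𝓝 x] free (state z (above x L) c) := by
  have h1 := h.sol_left z c x
  have hc : cross z (x, ω x, (v x : ℝ)) (state z (above x L) c) = state z (above x L) c := by
    simp only [IsNode, not_or, not_not] at hx
    simp [cross, Node.weight, hx.1, hx.2]
  rw [hc] at h1
  rw [Filter.EventuallyEq, ← nhdsLT_sup_nhdsGE, eventually_sup]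
  exact ⟨h1, sol_right z L c x⟩

theorem Represents.isSolution_sol (h : Represents L ω v) (z : ℂ) (c : ℂ × ℂ) :
    IsSolution ω v z (sol z L c) := by
  refine ⟨continuous_iff_continuousAt.2 fun x => ?_, fun x hx => ?_, fun x hx => ?_, fun x _ => ?_⟩
  · rw [continuousAt_iff_continuous_left'_right']
    have hx : sol z L c x = free (state z (above x L) c) x := rfl
    refine ⟨?_, ?_⟩
    · have h1 : Tendsto (free (cross z (x, ω x, (v x : ℝ)) (state z (above x L) c))) (𝓝[<] x)
          (𝓝 (sol z L c x)) := by
        rw [hx, ← free_cross z (x, ω x, (v x : ℝ))]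
        exact ((continuous_free _).tendsto _).mono_left nhdsWithin_le_nhds
      exact h1.congr' (by filter_upwards [h.sol_left z c x] with y hy using hy.symm)
    · have h1 : Tendsto (free (state z (above x L) c)) (𝓝[>] x) (𝓝 (sol z L c x)) :=
        ((continuous_free _).tendsto _).mono_left nhdsWithin_le_nhds
      refine h1.congr' ?_
      filter_upwards [nhdsWithin_mono x Set.Ioi_subset_Ici_self (sol_right z L c x)] with y hy using hy.symm
  · exact ((hasDerivAt_free _ x).differentiableAt).congr_of_eventuallyEq (h.sol_nhds z c hx)
  · have h1 := (h.sol_nhds z c hx).deriv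
    rw [deriv_free] at h1
    refine ⟨_, (hasDerivAt_free _ x).congr_of_eventuallyEq h1, ?_⟩
    simp only [sol, free, diffCoeff]
    ring
  · refine ⟨_, _, tendsto_deriv_of_eventuallyEq_free nhdsWithin_le_nhds
      (eventually_nhds_of_nhdsLT (h.sol_left z c x)),
      tendsto_deriv_of_eventuallyEq_free nhdsWithin_le_nhds
      (eventually_nhds_of_nhdsGT (nhdsWithin_mono x Set.Ioi_subset_Ici_self (sol_right z L c x))), ?_⟩
    rw [free_diffCoeff_cross z (x, ω x, (v x : ℝ))]
    simp only [Node.weight, sol, Complex.coe_algebraMap]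
    ring

theorem IsSolution.exists_limits {z : ℂ} {f : ℝ → ℂ} (hf : IsSolution ω v z f) (x : ℝ) :
    ∃ dl dr : ℂ, Tendsto (deriv f) (𝓝[<] x) (𝓝 dl) ∧ Tendsto (deriv f) (𝓝[>] x) (𝓝 dr) ∧
      dl = dr + z * (ω x : ℂ) * f x + z ^ 2 * ((v x : ℝ) : ℂ) * f x := by
  by_cases hx : IsNode ω v x
  · exact hf.jump x hx
  · obtain ⟨f₂, h1, -⟩ := hf.equation x hx
    refine ⟨_, _, h1.continuousAt.tendsto.mono_left nhdsWithin_le_nhds,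
      h1.continuousAt.tendsto.mono_left nhdsWithin_le_nhds, ?_⟩
    simp only [IsNode, not_or, not_not] at hx
    simp [hx.1, hx.2]

theorem finite_isNode (ω : ℝ →₀ ℝ) (v : ℝ →₀ ℝ≥0) : {x | IsNode ω v x}.Finite := by
  refine (ω.support ∪ v.support).finite_toSet.subset fun x hx => ?_
  simpa [IsNode] using hx

theorem Represents.exists_above_eq_nil (h : Represents L ω v) :
    ∃ b, (∀ x, b ≤ x → above x L = []) ∧ ∀ x, b < x → ¬ IsNode ω v x := by
  obtain ⟨b, hb⟩ := (finite_isNode ω v).bddAbove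
  refine ⟨b, fun x hx => ?_, fun x hx hn => (hb hn).not_gt hx⟩
  rw [above, List.filter_eq_nil_iff]
  intro n hn
  simpa using (hb ((h.mem_iff n).1 hn).1).trans hx

theorem Represents.exists_above_eq_self (h : Represents L ω v) :
    ∃ b, ∀ x, x ≤ b → above x L = L := by
  obtain ⟨b, hb⟩ := (finite_isNode ω v).bddBelow
  refine ⟨b - 1, fun x hx => ?_⟩
  rw [above, List.filter_eq_self]
  intro n hn
  have := hb ((h.mem_iff n).1 hn).1
  simp only [decide_eq_true_eq]
  linarith

/-- Match the solutions near `+∞` and let `s` be the supremum of the points where they differ. At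
`s` the values and right derivatives agree, hence by the jump condition the left derivatives, so
both continue as the same free solution to the left of `s`. -/
theorem Represents.eq_sol (h : Represents L ω v) {z : ℂ} {f : ℝ → ℂ} (hf : IsSolution ω v z f) :
    ∃ c, f = sol z L c := by
  obtain ⟨b, hb, hbn⟩ := h.exists_above_eq_nil
  obtain ⟨c, hc⟩ := hf.exists_free isOpen_Ioi isPreconnected_Ioi hbn
  refine ⟨c, ?_⟩
  have hg := h.isSolution_sol z c
  have hb' : ∀ y, b < y → f y = sol z L c y := fun y hy => by
    rw [hc y hy, sol, hb y hy.le, state_nil]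
  by_contra hne
  obtain ⟨w, hw⟩ : ∃ w, f w ≠ sol z L c w := by
    by_contra hcon
    push Not at hcon
    exact hne (funext hcon)
  set S := {x | f x ≠ sol z L c x} with hS
  have hSb : BddAbove S := ⟨b, fun x hx => le_of_not_gt fun hlt => hx (hb' x hlt)⟩
  set s := sSup S with hs
  have hgt : ∀ y, s < y → f y = sol z L c y := fun y hy => by
    by_contra hy'
    exact (le_csSup hSb hy').not_gt hy
  have hat : f s = sol z L c s := by
    refine tendsto_nhds_unique (f := f) (l := 𝓝[>] s)
      (hf.continuous.continuousAt.mono_left nhdsWithin_le_nhds) ?_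
    refine ((hg.continuous.continuousAt (x := s)).mono_left nhdsWithin_le_nhds).congr' ?_
    filter_upwards [self_mem_nhdsWithin] with y hy using (hgt y hy).symm
  obtain ⟨dl, dr, hl, hr, hj⟩ := hf.exists_limits s
  obtain ⟨dl', dr', hl', hr', hj'⟩ := hg.exists_limits s
  have hdr : dr = dr' := by
    refine tendsto_nhds_unique hr (hr'.congr' ?_)
    filter_upwards [self_mem_nhdsWithin] with y hy
    refine Filter.EventuallyEq.deriv_eq ?_
    filter_upwards [Ioi_mem_nhds hy] with u hu using (hgt u hu).symm
  have hdl : dl = dl' := by rw [hj, hj', hdr, hat]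
  have hnl : ∃ p < s, ∀ x ∈ Set.Ioo p s, ¬ IsNode ω v x := by
    have h1 : ({x | IsNode ω v x} \ {s})ᶜ ∈ 𝓝 s :=
      ((finite_isNode ω v).subset Set.sdiff_subset).isClosed.isOpen_compl.mem_nhds (by simp)
    obtain ⟨p, hp, hsub⟩ := (mem_nhdsLE_iff_exists_Ioc_subset (a := s)).1 (mem_nhdsWithin_of_mem_nhds h1)
    exact ⟨p, hp, fun x hx hxn => hsub ⟨hx.1, hx.2.le⟩ ⟨hxn, hx.2.ne⟩⟩
  obtain ⟨p, hp, hpn⟩ := hnl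
  obtain ⟨d, hd⟩ := hf.exists_free isOpen_Ioo isPreconnected_Ioo hpn
  have hdl1 : ∀ᶠ y in 𝓝[<] s, f y = free d y := by
    filter_upwards [Ioo_mem_nhdsLT hp] with y hy using hd y hy
  have hdl2 := h.sol_left z c s
  have key : d = cross z (s, ω s, (v s : ℝ)) (state z (above s L) c) := by
    refine free_injective (x := s) ?_ ?_
    · refine tendsto_nhds_unique (l := 𝓝[<] s)
        (((continuous_free d).tendsto s).mono_left nhdsWithin_le_nhds) ?_
      have h1 : free (cross z (s, ω s, (v s : ℝ)) (state z (above s L) c)) s = f s := by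
        rw [free_cross z (s, ω s, (v s : ℝ)), hat, sol]
      rw [h1]
      exact ((hf.continuous.tendsto s).mono_left nhdsWithin_le_nhds).congr' hdl1
    · rw [tendsto_nhds_unique (tendsto_deriv_of_eventuallyEq_free nhdsWithin_le_nhds
          (eventually_nhds_of_nhdsLT hdl1)) hl,
        tendsto_nhds_unique (tendsto_deriv_of_eventuallyEq_free nhdsWithin_le_nhds
          (eventually_nhds_of_nhdsLT hdl2)) hl', hdl]
  have hev : ∀ᶠ y in 𝓝[<] s, f y = sol z L c y := by
    filter_upwards [hdl1, hdl2] with y h1 h2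
    rw [h1, h2, key]
  obtain ⟨p', hp', hsub⟩ := (mem_nhdsLT_iff_exists_Ioo_subset (a := s)).1 hev
  obtain ⟨x, hxS, hx⟩ := exists_lt_of_lt_csSup ⟨w, hw⟩ hp'
  rcases (le_csSup hSb hxS).lt_or_eq with hlt | heq
  · exact hxS (hsub ⟨hx, hlt⟩)
  · exact hxS (by rw [heq]; exact hat)

end Sol

/-! ### Spectrum and interior data in terms of polynomials -/

section

variable {L : List Node} {ω : ℝ →₀ ℝ} {v : ℝ →₀ ℝ≥0}

theorem state_eq_aeval {A : Type*} [CommRing A] [Algebra ℝ A] (z : A) (L : List Node) :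
    state z L (1, 0) = (aeval z (state (X : ℝ[X]) L (1, 0)).1,
      aeval z (state (X : ℝ[X]) L (1, 0)).2) := by
  have := map_state (aeval z : ℝ[X] →ₐ[ℝ] A) X L (1, 0)
  simpa using this

theorem sol_one_zero_eq (lam : ℝ) (L : List Node) (x : ℝ) :
    sol lam L (1, 0) x =
      ((Real.exp (-x / 2) * (valuePoly x (above x L)).eval lam : ℝ) : ℂ) := by
  have h : ∀ Q : ℝ[X], aeval (lam : ℂ) Q = ((Q.eval lam : ℝ) : ℂ) := fun Q => by
    rw [← Complex.coe_algebraMap, aeval_algebraMap_apply]; simp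
  have he : Real.exp (x / 2) = Real.exp (-x / 2) * Real.exp x := by
    rw [← Real.exp_add]; ring_nf
  rw [sol, state_eq_aeval, free, h, h, he, valuePoly]
  simp only [eval_add, eval_mul, eval_C]
  push_cast
  ring

theorem Represents.isPhiPlus_iff (h : Represents L ω v) {z : ℂ} {φ : ℝ → ℂ} :
    IsPhiPlus ω v z φ ↔ φ = sol z L (1, 0) := by
  obtain ⟨b, hb, -⟩ := h.exists_above_eq_nil
  have hfree : ∀ c y, b ≤ y → sol z L c y = free c y := fun c y hy => by
    rw [sol, hb y hy, state_nil]
  have h1 : ∀ y, (Real.exp (-y / 2) : ℂ) = free (1, 0) y := fun y => by simp [free]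
  constructor
  · rintro ⟨hs, he⟩
    obtain ⟨c, rfl⟩ := h.eq_sol hs
    obtain ⟨B, hB⟩ := eventually_atTop.1 he
    have hev : ∀ᶠ y in 𝓝 (max b B + 1), free c y = free (1, 0) y := by
      filter_upwards [Ioi_mem_nhds (lt_add_one (max b B))] with y hy
      have hy' : max b B < y := hy
      rw [← hfree c y ((le_max_left _ _).trans hy'.le), hB y ((le_max_right _ _).trans hy'.le), h1]
    rw [free_injective (x := max b B + 1) hev.self_of_nhds (by
      rw [← deriv_free, ← deriv_free]
      exact Filter.EventuallyEq.deriv_eq hev)]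
  · rintro rfl
    refine ⟨h.isSolution_sol z _, ?_⟩
    filter_upwards [eventually_ge_atTop b] with y hy
    rw [hfree _ y hy, h1]

theorem snd_eq_zero_of_bounded {c : ℂ × ℂ} {b C : ℝ} (h : ∀ x, b ≤ x → ‖free c x‖ ≤ C) :
    c.2 = 0 := by
  by_contra hc
  have hc' : 0 < ‖c.2‖ := norm_pos_iff.2 hc
  have ht : Tendsto (fun x : ℝ => Real.exp (x / 2) * ‖c.2‖) atTop atTop :=
    (Real.tendsto_exp_atTop.comp (tendsto_id.atTop_div_const two_pos)).atTop_mul_const hc'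
  obtain ⟨x, hx1, hx2, hx3⟩ := ((ht.eventually_gt_atTop (C + ‖c.1‖)).and
    ((eventually_ge_atTop b).and (eventually_ge_atTop 0))).exists
  have h1 : (Real.exp (x / 2) : ℂ) * c.2 = free c x - (Real.exp (-x / 2) : ℂ) * c.1 := by
    simp [free]
  have h2 := norm_sub_le (free c x) ((Real.exp (-x / 2) : ℂ) * c.1)
  rw [← h1, norm_mul, norm_mul, Complex.norm_of_nonneg (Real.exp_pos _).le,
    Complex.norm_of_nonneg (Real.exp_pos _).le] at h2
  have h3 : Real.exp (-x / 2) ≤ 1 := Real.exp_le_one_iff.2 (by linarith)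
  have h4 := mul_le_of_le_one_left (norm_nonneg c.1) h3
  linarith [h x hx2]

theorem fst_eq_zero_of_bounded {c : ℂ × ℂ} {b C : ℝ} (h : ∀ x, x ≤ b → ‖free c x‖ ≤ C) :
    c.1 = 0 := by
  refine snd_eq_zero_of_bounded (c := c.swap) (b := -b) (C := C) fun x hx => ?_
  have := h (-x) (by linarith)
  simp only [free, neg_neg, Prod.fst_swap, Prod.snd_swap] at this ⊢
  rwa [add_comm]

/-- Boundedness at `+∞` leaves a multiple of `φ₊`; boundedness at `-∞` then kills its coefficient of
`exp (-x / 2)` on the left, which is the Wronski polynomial. -/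
theorem Represents.mem_spectrum_iff (h : Represents L ω v) {z : ℂ} :
    z ∈ spectrum ω v ↔ aeval z (wronskiPoly L) = 0 := by
  obtain ⟨b, hb, -⟩ := h.exists_above_eq_nil
  obtain ⟨b', hb'⟩ := h.exists_above_eq_self
  have hr : ∀ c y, b ≤ y → sol z L c y = free c y := fun c y hy => by
    rw [sol, hb y hy, state_nil]
  have hl : ∀ c y, y ≤ b' → sol z L c y = free (state z L c) y := fun c y hy => by
    rw [sol, hb' y hy]
  constructor
  · rintro ⟨f, hf, hf0, C, hC⟩
    obtain ⟨c, rfl⟩ := h.eq_sol hf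
    have h2 : c.2 = 0 := snd_eq_zero_of_bounded (b := b) (C := C) fun x hx => by
      rw [← hr c x hx]; exact hC x
    have h1 : (state z L c).1 = 0 := fst_eq_zero_of_bounded (b := b') (C := C) fun x hx => by
      rw [← hl c x hx]; exact hC x
    have hc : c = c.1 • ((1 : ℂ), (0 : ℂ)) := by ext <;> simp [h2]
    have hc1 : c.1 ≠ 0 := fun h0 => hf0 <| by
      funext x
      rw [hc, h0, sol, state_smul]
      simp [free]
    rw [hc, state_smul, state_eq_aeval] at h1
    exact (mul_eq_zero.1 h1).resolve_left hc1
  · intro hz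
    refine ⟨sol z L (1, 0), h.isSolution_sol z _, fun h0 => ?_, ?_⟩
    · have := congrFun h0 b
      rw [hr _ b le_rfl] at this
      simp [free] at this
    · have hcont := (h.isSolution_sol z (1, 0)).continuous
      obtain ⟨C, hC⟩ := (isCompact_Icc (a := b') (b := b)).exists_bound_of_continuousOn
        hcont.continuousOn
      have hst : (state z L ((1 : ℂ), (0 : ℂ))).1 = 0 := by rw [state_eq_aeval]; exact hz
      refine ⟨max C (max (Real.exp (-b / 2)) (Real.exp (b' / 2) * ‖(state z L ((1 : ℂ), (0 : ℂ))).2‖)),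
        fun x => ?_⟩
      rcases le_total b x with hx | hx
      · rw [hr _ x hx, free, mul_zero, add_zero, mul_one, Complex.norm_of_nonneg (Real.exp_pos _).le]
        refine le_max_of_le_right (le_max_of_le_left (Real.exp_le_exp.2 (by linarith)))
      · rcases le_total x b' with hx' | hx'
        · rw [hl _ x hx', free, hst, mul_zero, zero_add, norm_mul,
            Complex.norm_of_nonneg (Real.exp_pos _).le]
          refine le_max_of_le_right (le_max_of_le_right ?_)
          exact mul_le_mul_of_nonneg_right (Real.exp_le_exp.2 (by linarith)) (norm_nonneg _)
        · exact le_max_of_le_left (hC x ⟨hx', hx⟩)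

theorem eval_gammaPoly {L : List Node} (hL : L.Pairwise fun m n => m.1 < n.1) (lam : ℝ) :
    (gammaPoly L).eval lam = (L.map fun n : Node => (n.2.1 + 2 * lam * n.2.2) *
      (Real.exp (-n.1) * (valuePoly n.1 (above n.1 L)).eval lam ^ 2)).sum := by
  induction L with
  | nil => simp [gammaPoly]
  | cons n L ih =>
    obtain ⟨h1, h2⟩ := List.pairwise_cons.1 hL
    have hn : above n.1 (n :: L) = L := by
      rw [above, List.filter_cons, if_neg (by simp), List.filter_eq_self]
      intro m hm
      simpa using h1 m hm
    have hm : ∀ m ∈ L, above m.1 (n :: L) = above m.1 L := fun m hm => by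
      rw [above, List.filter_cons, if_neg (by simpa using (h1 m hm).le)]
      rfl
    rw [List.map_cons, List.sum_cons, hn, gammaPoly, eval_add, ih h2]
    congr 1
    · simp only [eval_mul, eval_add, eval_C, eval_X, eval_pow]
      ring
    · congr 1
      refine List.map_congr_left fun m hmL => ?_
      rw [hm m hmL]

theorem Represents.gammaSq_eq (h : Represents L ω v) (lam : ℝ) :
    gammaSq ω v lam (sol lam L (1, 0)) = (gammaPoly L).eval lam := by
  rw [eval_gammaPoly h.sorted]
  have hnd : (L.map Prod.fst).Nodup := by
    rw [List.Nodup, List.pairwise_map]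
    exact h.sorted.imp fun h => h.ne
  have hsub1 : ω.support ⊆ (L.map Prod.fst).toFinset := fun x hx => by
    rw [List.mem_toFinset, List.mem_map]
    exact ⟨(x, ω x, (v x : ℝ)), (h.mem_iff _).2 ⟨Or.inl (Finsupp.mem_support_iff.1 hx), rfl, rfl⟩, rfl⟩
  have hsub2 : v.support ⊆ (L.map Prod.fst).toFinset := fun x hx => by
    rw [List.mem_toFinset, List.mem_map]
    exact ⟨(x, ω x, (v x : ℝ)), (h.mem_iff _).2 ⟨Or.inr (Finsupp.mem_support_iff.1 hx), rfl, rfl⟩, rfl⟩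
  rw [gammaSq, Finsupp.sum_of_support_subset _ hsub1 _ (by simp),
    Finsupp.sum_of_support_subset _ hsub2 _ (by simp), Finset.mul_sum, ← Finset.sum_add_distrib,
    List.sum_toFinset _ hnd, List.map_map]
  congr 1
  refine List.map_congr_left fun n hn => ?_
  obtain ⟨-, h1, h2⟩ := (h.mem_iff n).1 hn
  have he : Real.exp (-n.1) = Real.exp (-n.1 / 2) ^ 2 := by
    rw [sq, ← Real.exp_add]; ring_nf
  simp only [Function.comp_apply, sol_one_zero_eq, Complex.norm_real, Real.norm_eq_abs, sq_abs,
    ← h1, ← h2, he]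
  ring

/-- The reflected nodes to the left of `a`. -/
noncomputable def belowReflect (a : ℝ) (L : List Node) : List Node :=
  reflect (L.filter fun n => n.1 < a)

theorem filter_append_eq {L : List Node} (hL : L.Pairwise fun m n => m.1 < n.1) (x : ℝ) :
    L = (L.filter fun n => n.1 < x) ++ ((L.filter fun n => n.1 = x) ++ above x L) := by
  rw [← filter_le_eq_append hL]
  induction L with
  | nil => rfl
  | cons n L ih =>
    have ih := ih (List.pairwise_cons.1 hL).2
    have hlt := (List.pairwise_cons.1 hL).1
    rcases lt_or_ge n.1 x with h | h
    · simpa [h, h.not_ge] using ih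
    · have h0 : (n :: L).filter (fun n => n.1 < x) = [] := by
        rw [List.filter_eq_nil_iff]
        intro m hm
        rcases List.mem_cons.1 hm with rfl | hm
        · simpa using h
        · simpa using h.trans (hlt m hm).le
      rw [h0, List.nil_append, eq_comm, List.filter_eq_self]
      intro m hm
      rcases List.mem_cons.1 hm with rfl | hm
      · simpa using h
      · simpa using h.trans (hlt m hm).le

theorem Represents.state_split (h : Represents L ω v) (a : ℝ) {A : Type*} [CommRing A]
    [Algebra ℝ A] (z : A) (c : A × A) :
    state z L c = state z (reflect (belowReflect a L) ++ (a, ω a, (v a : ℝ)) :: above a L) c := by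
  conv_lhs => rw [filter_append_eq h.sorted a]
  rw [belowReflect, reflect_reflect, state_append, state_append, state_append, h.state_filter_eq,
    state_cons]

theorem isAbove_iff {L : List Node} : ∀ {a : ℝ}, IsAbove a L ↔ L.Pairwise (fun m n => m.1 < n.1) ∧
    ∀ n ∈ L, a < n.1 ∧ (n.2.1 ≠ 0 ∨ n.2.2 ≠ 0) ∧ 0 ≤ n.2.2 := by
  induction L with
  | nil => simp [IsAbove]
  | cons n L ih =>
    intro a
    rw [IsAbove, ih, List.pairwise_cons, List.forall_mem_cons]
    constructor
    · rintro ⟨h1, h2, h3, h4, h5⟩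
      exact ⟨⟨fun m hm => (h5 m hm).1, h4⟩, ⟨h1, h2, h3⟩,
        fun m hm => ⟨h1.trans (h5 m hm).1, (h5 m hm).2⟩⟩
    · rintro ⟨⟨h1, h2⟩, ⟨h3, h4, h5⟩, h6⟩
      exact ⟨h3, h4, h5, h2, fun m hm => ⟨h1 m hm, (h6 m hm).2⟩⟩

theorem Represents.weight_ne_zero (h : Represents L ω v) {n : Node} (hn : n ∈ L) :
    (n.2.1 ≠ 0 ∨ n.2.2 ≠ 0) ∧ 0 ≤ n.2.2 := by
  obtain ⟨h1, h2, h3⟩ := (h.mem_iff n).1 hn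
  rw [h2, h3]
  refine ⟨h1.imp_right fun h => ?_, NNReal.coe_nonneg _⟩
  exact_mod_cast h

theorem Represents.isAbove_above (h : Represents L ω v) (a : ℝ) : IsAbove a (above a L) := by
  refine isAbove_iff.2 ⟨h.sorted.filter _, fun n hn => ?_⟩
  simp only [above, List.mem_filter, decide_eq_true_eq] at hn
  exact ⟨hn.2, h.weight_ne_zero hn.1⟩

theorem pairwise_reflect {L : List Node} (hL : L.Pairwise fun m n => m.1 < n.1) :
    (reflect L).Pairwise fun m n => m.1 < n.1 := by
  rw [reflect, List.pairwise_reverse, List.pairwise_map]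
  exact hL.imp fun h => neg_lt_neg h

theorem mem_reflect {L : List Node} {n : Node} : n ∈ reflect L ↔ (-n.1, n.2) ∈ L := by
  simp only [reflect, List.mem_reverse, List.mem_map]
  constructor
  · rintro ⟨m, hm, rfl⟩; simpa using hm
  · intro h; exact ⟨_, h, by simp⟩

theorem Represents.isAbove_belowReflect (h : Represents L ω v) (a : ℝ) :
    IsAbove (-a) (belowReflect a L) := by
  refine isAbove_iff.2 ⟨pairwise_reflect (h.sorted.filter _), fun n hn => ?_⟩
  rw [belowReflect, mem_reflect] at hn
  simp only [List.mem_filter, decide_eq_true_eq] at hn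
  exact ⟨by linarith [hn.2], h.weight_ne_zero (n := (-n.1, n.2)) hn.1⟩

theorem exists_represents (ω : ℝ →₀ ℝ) (v : ℝ →₀ ℝ≥0) : ∃ L, Represents L ω v := by
  refine ⟨((ω.support ∪ v.support).sort (· ≤ ·)).map fun x => (x, ω x, (v x : ℝ)), ?_, fun n => ?_⟩
  · rw [List.pairwise_map]
    exact (Finset.sortedLT_sort _).pairwise
  · simp only [List.mem_map, Finset.mem_sort, Finset.mem_union, Finsupp.mem_support_iff]
    constructor
    · rintro ⟨x, hx, rfl⟩; exact ⟨hx, rfl, rfl⟩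
    · rintro ⟨h1, h2, h3⟩; exact ⟨n.1, h1, Prod.ext rfl (Prod.ext h2.symm h3.symm)⟩

theorem exists_measures_of_list {L : List Node} (hL : L.Pairwise fun m n => m.1 < n.1)
    (hw : ∀ n ∈ L, (n.2.1 ≠ 0 ∨ n.2.2 ≠ 0) ∧ 0 ≤ n.2.2) : ∃ ω v, Represents L ω v := by
  induction L with
  | nil => exact ⟨0, 0, List.Pairwise.nil, fun n => by simp [IsNode]⟩
  | cons n L ih =>
    obtain ⟨h1, h2⟩ := List.pairwise_cons.1 hL
    obtain ⟨ω, v, h⟩ := ih h2 fun m hm => hw m (List.mem_cons_of_mem _ hm)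
    obtain ⟨hn, hn0⟩ := hw n List.mem_cons_self
    obtain ⟨u, hu⟩ : ∃ u : ℝ≥0, (u : ℝ) = n.2.2 := ⟨⟨n.2.2, hn0⟩, rfl⟩
    refine ⟨ω.update n.1 n.2.1, v.update n.1 u, hL, fun m => ?_⟩
    simp only [IsNode, Finsupp.coe_update, Function.update_apply, List.mem_cons]
    by_cases hmn : m.1 = n.1
    · simp only [hmn, if_true, hu]
      constructor
      · rintro (rfl | hm)
        · refine ⟨hn.imp_right fun h0 h1 => h0 ?_, rfl, rfl⟩
          rw [← hu, h1, NNReal.coe_zero]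
        · exact absurd hmn (h1 m hm).ne'
      · rintro ⟨-, h3, h4⟩
        exact Or.inl (Prod.ext hmn (Prod.ext h3 h4))
    · simp only [hmn, if_false]
      rw [h.mem_iff m]
      exact ⟨fun h => h.resolve_left fun h0 => hmn (by rw [h0]), Or.inr⟩

theorem Represents.measures_eq {ω' : ℝ →₀ ℝ} {v' : ℝ →₀ ℝ≥0} (h : Represents L ω v)
    (h' : Represents L ω' v') : ω' = ω ∧ v' = v := by
  have key : ∀ x, ω' x = ω x ∧ v' x = v x := fun x => by
    by_cases hx : IsNode ω v x
    · obtain ⟨-, h1, h2⟩ := (h'.mem_iff _).1 ((h.mem_iff (x, ω x, (v x : ℝ))).2 ⟨hx, rfl, rfl⟩)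
      exact ⟨h1.symm, (NNReal.coe_injective h2).symm⟩
    · by_cases hx' : IsNode ω' v' x
      · obtain ⟨h0, -⟩ := (h.mem_iff _).1 ((h'.mem_iff (x, ω' x, (v' x : ℝ))).2 ⟨hx', rfl, rfl⟩)
        exact absurd h0 hx
      · simp only [IsNode, not_or, not_not] at hx hx'
        rw [hx.1, hx.2, hx'.1, hx'.2]; simp
  exact ⟨Finsupp.ext fun x => (key x).1, Finsupp.ext fun x => (key x).2⟩

/-- Squaring the normalisation and eliminating `γ²` expresses the product of the value polynomials
by `p²`; the sign lost in squaring is kept as a separate condition. -/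
theorem Represents.isInteriorSpectralData_iff (h : Represents L ω v) (a : ℝ) {N : ℕ}
    {lam p : Fin N → ℝ} (hp : ∀ i, p i ≠ 0) :
    IsInteriorSpectralData a ω v lam p ↔ StrictMono lam ∧
      (∀ z : ℂ, aeval z (wronskiPoly L) = 0 ↔ ∃ i, (lam i : ℂ) = z) ∧
      ∀ i, (derivative (wronskiPoly L)).eval (lam i) ≠ 0 ∧
        (valuePoly a (above a L) * valuePoly (-a) (belowReflect a L)).eval (lam i) =
          -(lam i * (derivative (wronskiPoly L)).eval (lam i) * p i ^ 2) ∧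
        0 < (valuePoly a (above a L)).eval (lam i) * p i := by
  have hspec : spectrum ω v = Set.range (fun i => (lam i : ℂ)) ↔
      ∀ z : ℂ, aeval z (wronskiPoly L) = 0 ↔ ∃ i, (lam i : ℂ) = z := by
    rw [Set.ext_iff]
    simp only [h.mem_spectrum_iff, Set.mem_range]
  have hval : ∀ i, (∃ φ : ℝ → ℂ, IsPhiPlus ω v (lam i) φ ∧
      (p i : ℂ) = φ a / (Real.sqrt (lam i * gammaSq ω v (lam i) φ) : ℂ)) ↔
      p i = Real.exp (-a / 2) * (valuePoly a (above a L)).eval (lam i) /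
        Real.sqrt (lam i * (gammaPoly L).eval (lam i)) := fun i => by
    simp only [h.isPhiPlus_iff, exists_eq_left, h.gammaSq_eq, sol_one_zero_eq]
    norm_cast
  have hmul : ∀ i, (wronskiPoly L).eval (lam i) = 0 →
      (valuePoly a (above a L) * valuePoly (-a) (belowReflect a L)).eval (lam i) *
        (gammaPoly L).eval (lam i) = -(derivative (wronskiPoly L)).eval (lam i) *
          (Real.exp (-a / 2) * (valuePoly a (above a L)).eval (lam i)) ^ 2 := fun i hi => by
    have := valuePoly_mul_gammaPoly (h.state_split a X (1, 0)) hi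
    rw [reflect_reflect] at this
    rw [this, mul_pow, sq (Real.exp (-a / 2)), ← Real.exp_add]
    ring_nf
  have hgam : ∀ i, (wronskiPoly L).eval (lam i) = 0 →
      (derivative (wronskiPoly L)).eval (lam i) = 0 → (gammaPoly L).eval (lam i) = 0 :=
    fun i h1 h2 => by
      rw [← wronskian_derivative_state]
      simp only [wronskiPoly] at h1 h2
      simp [h1, h2]
  have hroot : (∀ z : ℂ, aeval z (wronskiPoly L) = 0 ↔ ∃ i, (lam i : ℂ) = z) →
      ∀ i, (wronskiPoly L).eval (lam i) = 0 := fun hz i => by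
    have := (hz (lam i)).2 ⟨i, rfl⟩
    rw [← Complex.coe_algebraMap, aeval_algebraMap_apply] at this
    simpa using this
  have hequiv : ∀ i, (wronskiPoly L).eval (lam i) = 0 →
      ((p i = Real.exp (-a / 2) * (valuePoly a (above a L)).eval (lam i) /
        Real.sqrt (lam i * (gammaPoly L).eval (lam i))) ↔
      ((derivative (wronskiPoly L)).eval (lam i) ≠ 0 ∧
        (valuePoly a (above a L) * valuePoly (-a) (belowReflect a L)).eval (lam i) =
          -(lam i * (derivative (wronskiPoly L)).eval (lam i) * p i ^ 2) ∧
        0 < (valuePoly a (above a L)).eval (lam i) * p i)) := by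
    intro i hi
    have h1 := hmul i hi
    have h2 := hgam i hi
    have he := Real.exp_pos (-a / 2)
    have hpi := hp i
    generalize (valuePoly a (above a L) * valuePoly (-a) (belowReflect a L)).eval (lam i) = P at *
    generalize (valuePoly a (above a L)).eval (lam i) = Y at *
    generalize (derivative (wronskiPoly L)).eval (lam i) = W' at *
    generalize (gammaPoly L).eval (lam i) = g at *
    generalize lam i = l at *
    generalize p i = q at *
    generalize Real.exp (-a / 2) = e at *
    constructor
    · intro hq
      -- The square root of a nonpositive number is `0` and division by `0` gives `0`, so `q ≠ 0`
      -- forces `l * g > 0`.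
      have hs : Real.sqrt (l * g) ≠ 0 := fun h0 => by rw [h0, div_zero] at hq; exact hpi hq
      have hlg : 0 < l * g := by
        by_contra hcon
        exact hs (Real.sqrt_eq_zero'.2 (not_lt.1 hcon))
      have hspos : 0 < Real.sqrt (l * g) := Real.sqrt_pos.2 hlg
      have hg : g ≠ 0 := right_ne_zero_of_mul hlg.ne'
      have hY : e * Y = q * Real.sqrt (l * g) := by rw [hq, div_mul_cancel₀ _ hs]
      refine ⟨fun h0 => hg (h2 h0), ?_, ?_⟩
      · apply mul_right_cancel₀ hg
        rw [h1, hY, mul_pow, Real.sq_sqrt hlg.le]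
        ring
      · have h3 : e * (Y * q) = Real.sqrt (l * g) * q ^ 2 := by
          rw [← mul_assoc, hY]; ring
        have h4 : 0 < Real.sqrt (l * g) * q ^ 2 := by positivity
        rw [← h3] at h4
        exact pos_of_mul_pos_right h4 he.le
    · rintro ⟨hW, hP, hYq⟩
      have h3 : l * g * q ^ 2 = (e * Y) ^ 2 := by
        apply mul_left_cancel₀ (neg_ne_zero.2 hW)
        rw [← h1, hP]; ring
      have h4 : l * g = (e * Y / q) ^ 2 := by
        rw [div_pow, ← h3]; field_simp
      have hY : Y ≠ 0 := left_ne_zero_of_mul hYq.ne'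
      have h5 : 0 < e * Y / q := by
        have : e * Y / q = e * (Y * q) / q ^ 2 := by field_simp
        rw [this]; positivity
      rw [h4, Real.sqrt_sq h5.le]
      field_simp
  constructor
  · intro hd
    have hz := hspec.1 hd.spectrum_eq
    exact ⟨hd.strictMono, hz, fun i => (hequiv i (hroot hz i)).1 ((hval i).1 (hd.value i))⟩
  · rintro ⟨h1, h2, h3⟩
    exact ⟨h1, hspec.2 h2, fun i => (hval i).2 ((hequiv i (hroot h2 i)).2 (h3 i))⟩

end

/-! ### Degree relations and rigidity of the factorisation -/

/-- The conditions on the value and slope polynomials of a half-line. -/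
structure IsHalf (Y E : ℝ[X]) : Prop where
  eval_zero : Y.eval 0 = 1
  degree_lt : E.degree < Y.degree
  asymptotics : ∃ k : ℝ, 0 ≤ k ∧ (X * E + C k * Y).degree < Y.degree

/-- A Wronski polynomial in terms of the polynomials of the two half-lines and of the weights of
the point between them. -/
structure IsSplitting (W Yp Ep Ym Em : ℝ[X]) (w u : ℝ) : Prop where
  right : IsHalf Yp Ep
  left : IsHalf Ym Em
  eq : W = (1 - X * (C w + C u * X)) * (Yp * Ym) - X * Ep * Ym - X * Em * Yp

/-- The interior spectral data in terms of polynomials. -/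
structure HasData {N : ℕ} (lam p : Fin N → ℝ) (W Yp Ym : ℝ[X]) : Prop where
  strictMono : StrictMono lam
  roots : ∀ z : ℂ, aeval z W = 0 ↔ ∃ i, (lam i : ℂ) = z
  eval_zero : W.eval 0 = 1
  derivative_ne_zero : ∀ i, (derivative W).eval (lam i) ≠ 0
  value : ∀ i, (Yp * Ym).eval (lam i) = -(lam i * (derivative W).eval (lam i) * p i ^ 2)
  sign : ∀ i, 0 < Yp.eval (lam i) * p i

theorem IsHalf.ne_zero {Y E : ℝ[X]} (h : IsHalf Y E) : Y ≠ 0 := fun h0 => by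
  simpa [h0] using h.eval_zero

theorem aeval_ofReal (lam : ℝ) (Q : ℝ[X]) : aeval (lam : ℂ) Q = ((Q.eval lam : ℝ) : ℂ) := by
  rw [← Complex.coe_algebraMap, aeval_algebraMap_apply]; simp

section Data

variable {N : ℕ} {lam p : Fin N → ℝ} {W Yp Ym : ℝ[X]}

theorem HasData.eval_eq_zero_iff (h : HasData lam p W Yp Ym) (x : ℝ) :
    W.eval x = 0 ↔ ∃ i, lam i = x := by
  have := h.roots x
  rw [aeval_ofReal] at this
  exact_mod_cast this

theorem HasData.ne_zero (h : HasData lam p W Yp Ym) : W ≠ 0 := fun h0 => by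
  simpa [h0] using h.eval_zero

theorem HasData.lam_ne_zero (h : HasData lam p W Yp Ym) (i : Fin N) : lam i ≠ 0 := fun h0 => by
  have := (h.eval_eq_zero_iff 0).2 ⟨i, h0⟩
  rw [h.eval_zero] at this
  exact one_ne_zero this

theorem HasData.splits (h : HasData lam p W Yp Ym) : W.Splits :=
  splits_of_aeval_eq_zero_imp_im fun z hz => by
    obtain ⟨i, rfl⟩ := (h.roots z).1 hz
    simp

theorem HasData.eq_nodal (h : HasData lam p W Yp Ym) :
    W = C W.leadingCoeff * Lagrange.nodal Finset.univ lam := by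
  have h1 := eq_C_mul_nodal_roots h.splits fun μ hμ => by
    obtain ⟨i, rfl⟩ := (h.eval_eq_zero_iff μ).1 hμ
    exact h.derivative_ne_zero i
  have h2 : W.roots.toFinset = Finset.univ.image lam := by
    ext x
    rw [Multiset.mem_toFinset, mem_roots h.ne_zero, IsRoot.def, h.eval_eq_zero_iff]
    simp
  conv_lhs => rw [h1, h2, Lagrange.nodal, Finset.prod_image h.strictMono.injective.injOn]
  rfl

theorem HasData.natDegree_eq (h : HasData lam p W Yp Ym) : W.natDegree = N := by
  rw [h.eq_nodal, natDegree_C_mul (leadingCoeff_ne_zero.2 h.ne_zero), Lagrange.natDegree_nodal]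
  simp

theorem HasData.eq_of_hasData (h : HasData lam p W Yp Ym) {W' Yp' Ym' : ℝ[X]}
    (h' : HasData lam p W' Yp' Ym') : W' = W := by
  have h1 := congrArg (eval 0) h.eq_nodal
  have h2 := congrArg (eval 0) h'.eq_nodal
  rw [eval_mul, eval_C, h.eval_zero] at h1
  rw [eval_mul, eval_C, h'.eval_zero] at h2
  have h3 : W'.leadingCoeff = W.leadingCoeff := by
    apply mul_right_cancel₀ (b := eval 0 (Lagrange.nodal Finset.univ lam))
    · intro h0
      rw [h0, mul_zero] at h1
      exact one_ne_zero h1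
    · rw [← h1, ← h2]
  rw [h.eq_nodal, h'.eq_nodal, h3]

theorem HasData.coeff_eq_sum (h : HasData lam p W Yp Ym) {Q : ℝ[X]} (hQ : Q.degree < N) :
    Q.coeff (N - 1) =
      W.leadingCoeff * ∑ i, Q.eval (lam i) / (derivative W).eval (lam i) := by
  have := coeff_eq_sum_residues (s := Finset.univ) (v := lam) h.strictMono.injective.injOn
    (leadingCoeff_ne_zero.2 h.ne_zero) (N := Q) (by simpa using hQ)
  rw [← h.eq_nodal] at this
  simpa using this

/-- Sum of the residues `-c i` of `(Q - W) / (z W)`. Subtracting `W` makes the division by `z` exact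
and does not change the values at the eigenvalues. -/
theorem HasData.sum_eq (h : HasData lam p W Yp Ym) {Q : ℝ[X]} (hQ : Q.natDegree ≤ N) (hN : 0 < N)
    (h0 : Q.eval 0 = 1) {c : Fin N → ℝ}
    (hc : ∀ i, Q.eval (lam i) = -(lam i * (derivative W).eval (lam i) * c i)) :
    W.leadingCoeff * (1 - ∑ i, c i) = Q.coeff N := by
  have hX : X * (Q - W).divX = Q - W := by
    have := X_mul_divX_add (Q - W)
    rwa [coeff_zero_eq_eval_zero, eval_sub, h0, h.eval_zero, sub_self, C_0, add_zero] at this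
  have hdeg : (Q - W).divX.degree < N := by
    refine (degree_lt_iff_coeff_zero _ _).2 fun m hm => ?_
    rw [coeff_divX]
    refine coeff_eq_zero_of_natDegree_lt ?_
    have := natDegree_sub_le Q W
    rw [h.natDegree_eq] at this
    have := this.trans (max_le hQ le_rfl)
    omega
  have h1 := h.coeff_eq_sum hdeg
  have h2 : ∀ i, (Q - W).divX.eval (lam i) / (derivative W).eval (lam i) = -c i := fun i => by
    have h3 := congrArg (eval (lam i)) hX
    rw [eval_mul, eval_X, eval_sub, (h.eval_eq_zero_iff _).2 ⟨i, rfl⟩, sub_zero, hc] at h3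
    have := h.lam_ne_zero i
    rw [div_eq_iff (h.derivative_ne_zero i)]
    apply mul_left_cancel₀ this
    rw [h3]; ring
  rw [coeff_divX, Nat.sub_add_cancel hN, coeff_sub, Finset.sum_congr rfl fun i _ => h2 i,
    Finset.sum_neg_distrib] at h1
  have h3 : W.coeff N = W.leadingCoeff := by rw [leadingCoeff, h.natDegree_eq]
  rw [h3] at h1
  linear_combination -h1

theorem HasData.coeff_eq_sum_mul (h : HasData lam p W Yp Ym) {Q : ℝ[X]} (hQ : Q.degree < N)
    {c : Fin N → ℝ} (hc : ∀ i, Q.eval (lam i) = -(lam i * (derivative W).eval (lam i) * c i)) :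
    Q.coeff (N - 1) = W.leadingCoeff * (-∑ i, lam i * c i) := by
  rw [h.coeff_eq_sum hQ, ← Finset.sum_neg_distrib]
  congr 1
  refine Finset.sum_congr rfl fun i _ => ?_
  rw [hc, div_eq_iff (h.derivative_ne_zero i)]
  ring

/-- Up to lower order `z E₊` is a nonpositive multiple of `Y₊`, and likewise on the left, so `W` is
a quadratic times `Y₊ Y₋` up to lower order. -/
theorem IsSplitting.exists_eq {Ep Em : ℝ[X]} {w u : ℝ} (hs : IsSplitting W Yp Ep Ym Em w u) :
    ∃ k : ℝ, 0 ≤ k ∧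
      (W - (C (1 + k) - C w * X - C u * X ^ 2) * (Yp * Ym)).degree < (Yp * Ym).degree := by
  obtain ⟨k, hk, hk'⟩ := hs.right.asymptotics
  obtain ⟨l, hl, hl'⟩ := hs.left.asymptotics
  refine ⟨k + l, by positivity, ?_⟩
  have : W - (C (1 + (k + l)) - C w * X - C u * X ^ 2) * (Yp * Ym) =
      -((X * Ep + C k * Yp) * Ym + (X * Em + C l * Ym) * Yp) := by
    rw [hs.eq]
    simp only [C_add, C_1]
    ring
  rw [this, degree_neg]
  refine (degree_add_le _ _).trans_lt (max_lt ?_ ?_)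
  · rw [degree_mul, degree_mul]
    exact WithBot.add_lt_add_right (degree_ne_bot.2 hs.left.ne_zero) hk'
  · rw [degree_mul, degree_mul, add_comm Yp.degree]
    exact WithBot.add_lt_add_right (degree_ne_bot.2 hs.right.ne_zero) hl'

/-- The two sums fix `deg P = N - 1` and the leading coefficient of `P`. Then the quadratic factor
of `W` must have degree one, which removes `u` and gives `w`. -/
theorem HasData.splitting_facts (h : HasData lam p W Yp Ym) {Ep Em : ℝ[X]} {w u : ℝ}
    (hs : IsSplitting W Yp Ep Ym Em w u) (hα : 1 - ∑ i, p i ^ 2 = 0)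
    (hβ : -∑ i, lam i * p i ^ 2 ≠ 0) :
    (Yp * Ym).natDegree + 1 = N ∧ u = 0 ∧ w ≠ 0 ∧
      w * (-∑ i, lam i * p i ^ 2) = -1 ∧
      (Yp * Ym).leadingCoeff = W.leadingCoeff * (-∑ i, lam i * p i ^ 2) := by
  have hN : 0 < N := by
    rcases Nat.eq_zero_or_pos N with rfl | hN
    · simp at hα
    · exact hN
  obtain ⟨k, hk, hdeg⟩ := hs.exists_eq
  set P := Yp * Ym with hP
  have hP0 : P ≠ 0 := mul_ne_zero hs.right.ne_zero hs.left.ne_zero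
  set A : ℝ[X] := C (1 + k) - C w * X - C u * X ^ 2 with hA
  -- The constant term `1 + k` is positive because `k ≥ 0`.
  have hA0 : A ≠ 0 := fun h0 => by
    have := congrArg (eval 0) h0
    simp [hA] at this
    linarith
  have hPA : P.degree ≤ (A * P).degree := by
    rw [mul_comm]; exact degree_le_mul_left _ hA0
  have hWd : W.degree = (A * P).degree := by
    have : W = (W - A * P) + A * P := by ring
    rw [this, degree_add_eq_right_of_degree_lt (hdeg.trans_le hPA)]
  have hWl : W.leadingCoeff = A.leadingCoeff * P.leadingCoeff := by
    have : W = (W - A * P) + A * P := by ring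
    rw [this, leadingCoeff_add_of_degree_lt (hdeg.trans_le hPA), leadingCoeff_mul]
  have hnd : N = A.natDegree + P.natDegree := by
    rw [← h.natDegree_eq, natDegree_eq_of_degree_eq hWd, natDegree_mul hA0 hP0]
  have h1 := h.sum_eq (Q := P) (by omega) hN
    (by rw [hP, eval_mul, hs.right.eval_zero, hs.left.eval_zero, one_mul]) h.value
  rw [hα, mul_zero] at h1
  have hlt : P.natDegree < N := by
    rcases (show P.natDegree ≤ N by omega).lt_or_eq with h2 | h2
    · exact h2
    · rw [← h2, coeff_natDegree] at h1
      exact absurd h1.symm (leadingCoeff_ne_zero.2 hP0)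
  have h3 := h.coeff_eq_sum_mul (Q := P)
    (degree_le_natDegree.trans_lt (by exact_mod_cast hlt)) h.value
  have hW0 := leadingCoeff_ne_zero.2 h.ne_zero
  have h4 : N - 1 ≤ P.natDegree := le_natDegree_of_ne_zero (by rw [h3]; exact mul_ne_zero hW0 hβ)
  have hPN : P.natDegree + 1 = N := by omega
  have hPl : P.leadingCoeff = W.leadingCoeff * (-∑ i, lam i * p i ^ 2) := by
    rw [leadingCoeff, show P.natDegree = N - 1 by omega, h3]
  have hA1 : A.natDegree = 1 := by omega
  have hAu : u = 0 := by
    have := coeff_eq_zero_of_natDegree_lt (p := A) (n := 2) (by omega)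
    simp [hA, coeff_one] at this
    exact this
  have hAl : A.leadingCoeff = -w := by
    rw [leadingCoeff, hA1]
    simp [hA, coeff_one, coeff_C]
  have hw : w * (-∑ i, lam i * p i ^ 2) = -1 := by
    apply mul_left_cancel₀ hW0
    rw [hAl, hPl] at hWl
    linear_combination hWl
  exact ⟨hPN, hAu, fun h0 => by simp [h0] at hw, hw, hPl⟩

theorem HasData.isNevanlinna (h : HasData lam p W Yp Ym) {Q : ℝ[X]} (hQ : Q.natDegree < N)
    {c : Fin N → ℝ} (hc0 : ∀ i, 0 < c i)
    (hc : ∀ i, Q.eval (lam i) = -(lam i * (derivative W).eval (lam i) * c i)) :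
    IsNevanlinna (X * Q) W := by
  have hd : (X * Q).natDegree ≤ N := by
    refine natDegree_mul_le.trans ?_
    rw [natDegree_X]; omega
  refine ⟨h.ne_zero, h.splits, fun μ hμ => ?_, ?_, ?_⟩
  · obtain ⟨i, rfl⟩ := (h.eval_eq_zero_iff μ).1 hμ
    rw [eval_mul, eval_X, hc]
    have h1 := h.lam_ne_zero i
    have h2 := h.derivative_ne_zero i
    have h3 := hc0 i
    have : 0 < (lam i) ^ 2 * (derivative W).eval (lam i) ^ 2 * c i := by positivity
    nlinarith
  · rw [h.natDegree_eq]; omega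
  · rw [h.natDegree_eq, coeff_eq_zero_of_natDegree_lt (by omega), zero_mul]

/-- The value at `lam i` of the product of complementary factors of two candidates. -/
theorem HasData.exists_pos (h : HasData lam p W Yp Ym) {Zp Zm : ℝ[X]}
    (h' : HasData lam p W Zp Zm) (hP : Yp * Ym = Zp * Zm) :
    ∃ c : Fin N → ℝ, (∀ i, 0 < c i) ∧
      ∀ i, (Yp * Zm).eval (lam i) = -(lam i * (derivative W).eval (lam i) * c i) := by
  refine ⟨fun i => p i ^ 2 * (Yp.eval (lam i) / Zp.eval (lam i)), fun i => ?_, fun i => ?_⟩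
  · have h1 := h.sign i
    have h2 := h'.sign i
    have hp : p i ≠ 0 := right_ne_zero_of_mul h1.ne'
    have hZ : Zp.eval (lam i) ≠ 0 := left_ne_zero_of_mul h2.ne'
    have : p i ^ 2 * (Yp.eval (lam i) / Zp.eval (lam i)) =
        (Yp.eval (lam i) * p i) * (Zp.eval (lam i) * p i) / Zp.eval (lam i) ^ 2 := by
      field_simp
    simp only [this]
    positivity
  · have hZ : Zp.eval (lam i) ≠ 0 := left_ne_zero_of_mul (h'.sign i).ne'
    have h1 := h.value i
    rw [hP, eval_mul] at h1
    rw [eval_mul]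
    field_simp
    linear_combination (Yp.eval (lam i)) * h1

/-- A common zero of `F` and `G` would be a multiple pole. -/
theorem IsNevanlinna.isCoprime {M F G : ℝ[X]} (h : IsNevanlinna M (X * (F * G))) :
    IsCoprime F G := by
  refine (isCoprime_iff_aeval_ne_zero_of_isAlgClosed ℝ ℂ F G).2 fun z => ?_
  by_contra hcon
  rw [not_or, not_not, not_not] at hcon
  obtain ⟨μ, rfl⟩ := h.splits.mem_range_of_isRoot h.ne_zero (i := algebraMap ℝ ℂ) (x := z) (by
    rw [IsRoot.def, eval_map_algebraMap, map_mul, map_mul, hcon.1, hcon.2]; simp)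
  rw [Complex.coe_algebraMap, aeval_ofReal, aeval_ofReal] at hcon
  have hF : F.eval μ = 0 := by exact_mod_cast hcon.1
  have hG : G.eval μ = 0 := by exact_mod_cast hcon.2
  refine h.derivative_ne_zero μ (by simp [hF]) ?_
  simp [derivative_mul, hF, hG]

theorem HasData.isNevanlinna_inv (h : HasData lam p W Yp Ym) {Zp Zm : ℝ[X]}
    (h' : HasData lam p W Zp Zm) (hP : Yp * Ym = Zp * Zm) (hdeg : (Yp * Zm).natDegree < N) :
    IsNevanlinna (-W) (X * (Yp * Zm)) := by
  obtain ⟨c, hc0, hc⟩ := h.exists_pos h' hP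
  refine (h.isNevanlinna hdeg hc0 hc).neg_inv (mul_ne_zero X_ne_zero fun h0 => ?_)
  have hN : 0 < N := by omega
  have := hc ⟨0, hN⟩
  rw [h0, Polynomial.eval_zero, eq_comm, neg_eq_zero] at this
  exact mul_ne_zero (mul_ne_zero (h.lam_ne_zero _) (h.derivative_ne_zero _)) (hc0 _).ne' this

/-- `Yp` is coprime to `Zm` and divides `Zp * Zm`, hence `Zp = Yp * T`, and `deg (Yp * Zm) = N - 1 -
deg T`. Sums of residues weighted by powers of `lam` then limit `deg T`. -/
theorem HasData.exists_factor (h : HasData lam p W Yp Ym) {Zp Zm : ℝ[X]}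
    (h' : HasData lam p W Zp Zm) (hP : Yp * Ym = Zp * Zm) (hP0 : (Yp * Ym).eval 0 = 1)
    (hYp : Yp.eval 0 = 1) (hZp : Zp.eval 0 = 1)
    (hN : (Yp * Ym).natDegree + 1 = N) (hdeg : (Yp * Zm).natDegree < N) :
    Yp = Zp ∨ (Zp.natDegree = Yp.natDegree + 1 ∧ ¬ ((∀ i, 0 < lam i) ∨ ∀ i, lam i < 0)) := by
  have hcop : IsCoprime Yp Zm := (h.isNevanlinna_inv h' hP hdeg).isCoprime
  obtain ⟨T, hT⟩ : Yp ∣ Zp := hcop.dvd_of_dvd_mul_right (by rw [← hP]; exact dvd_mul_right _ _)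
  have hP00 : Yp * Ym ≠ 0 := fun h0 => by rw [h0] at hP0; simp at hP0
  have hPT : Yp * Ym = (Yp * Zm) * T := by rw [hP, hT]; ring
  have hQ0 : Yp * Zm ≠ 0 := fun h0 => by rw [hPT, h0, zero_mul] at hP00; exact hP00 rfl
  have hT0 : T ≠ 0 := fun h0 => by rw [hPT, h0, mul_zero] at hP00; exact hP00 rfl
  have hTe : T.eval 0 = 1 := by
    have := congrArg (eval 0) hT
    rw [eval_mul, hYp, hZp, one_mul] at this
    exact this.symm
  have hY0 : Yp ≠ 0 := left_ne_zero_of_mul hP00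
  have hdT : (Yp * Ym).natDegree = (Yp * Zm).natDegree + T.natDegree := by
    rw [hPT, natDegree_mul hQ0 hT0]
  have hdZ : Zp.natDegree = Yp.natDegree + T.natDegree := by rw [hT, natDegree_mul hY0 hT0]
  obtain ⟨c, hc0, hc⟩ := h.exists_pos h' hP
  have hNpos : 0 < N := by omega
  have hne : (Finset.univ : Finset (Fin N)).Nonempty := ⟨⟨0, hNpos⟩, Finset.mem_univ _⟩
  have hW0 := leadingCoeff_ne_zero.2 h.ne_zero
  rcases Nat.eq_zero_or_pos T.natDegree with hd | hd
  · left
    rw [eq_C_of_natDegree_eq_zero hd, eval_C] at hTe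
    rw [hT, eq_C_of_natDegree_eq_zero hd, hTe, C_1, mul_one]
  · right
    constructor
    -- If `deg T ≥ 2`, the `N - 1` coefficient of `X * (Yp * Zm)` vanishes, but it is a nonzero
    -- multiple of `∑ λ² c > 0`.
    · by_contra hne2
      have hXd : (X * (Yp * Zm)).natDegree < N - 1 := by
        rw [mul_comm, natDegree_mul_X hQ0]; omega
      have h1 := h.coeff_eq_sum_mul (Q := X * (Yp * Zm)) (c := fun i => lam i * c i)
        (degree_le_natDegree.trans_lt (by exact_mod_cast (by omega : _ < N)))
        fun i => by rw [eval_mul, eval_X, hc]; ring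
      rw [coeff_eq_zero_of_natDegree_lt hXd, eq_comm, mul_eq_zero, neg_eq_zero] at h1
      have h2 : 0 < ∑ i, lam i * (lam i * c i) := Finset.sum_pos (fun i _ => by
        have h3 := h.lam_ne_zero i
        have h4 := hc0 i
        have : lam i * (lam i * c i) = lam i ^ 2 * c i := by ring
        rw [this]; positivity) hne
      exact h2.ne' (h1.resolve_left hW0)
    -- As `deg T > 0`, the `N - 1` coefficient of `Yp * Zm` vanishes, so `∑ λ c = 0`.
    · have h1 := h.coeff_eq_sum_mul (Q := Yp * Zm) (c := c)
        (degree_le_natDegree.trans_lt (by exact_mod_cast hdeg)) hc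
      rw [coeff_eq_zero_of_natDegree_lt (by omega), eq_comm, mul_eq_zero, neg_eq_zero] at h1
      have h2 := h1.resolve_left hW0
      rintro (hs | hs)
      · exact (Finset.sum_pos (fun i _ => mul_pos (hs i) (hc0 i)) hne).ne' h2
      · exact (Finset.sum_neg (fun i _ => mul_neg_of_neg_of_pos (hs i) (hc0 i)) hne).ne h2

/-- The degrees of `Yp * Zm` and `Zp * Ym` add up to `2 (N - 1)`, so at least one of them is below
`N` and `HasData.exists_factor` applies in one of the two orders. -/
theorem HasData.eq_or_natDegree (h : HasData lam p W Yp Ym) {Zp Zm : ℝ[X]}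
    (h' : HasData lam p W Zp Zm) (hP : Yp * Ym = Zp * Zm) (hP0 : (Yp * Ym).eval 0 = 1)
    (hYp : Yp.eval 0 = 1) (hZp : Zp.eval 0 = 1) (hN : (Yp * Ym).natDegree + 1 = N) :
    Yp = Zp ∨ ((Zp.natDegree = Yp.natDegree + 1 ∨ Yp.natDegree = Zp.natDegree + 1) ∧
      ¬ ((∀ i, 0 < lam i) ∨ ∀ i, lam i < 0)) := by
  have hne : ∀ {F G : ℝ[X]}, (F * G).eval 0 = 1 → F ≠ 0 ∧ G ≠ 0 := fun h1 =>
    ⟨fun h0 => by simp [h0] at h1, fun h0 => by simp [h0] at h1⟩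
  obtain ⟨hY1, hY2⟩ := hne hP0
  obtain ⟨hZ1, hZ2⟩ := hne (hP ▸ hP0)
  have hd := natDegree_mul hY1 hY2
  have hd' := natDegree_mul hZ1 hZ2
  rw [← hP] at hd'
  rcases le_or_gt ((Yp * Zm).natDegree + 1) N with hle | hgt
  · rcases h.exists_factor h' hP hP0 hYp hZp hN hle with h1 | ⟨h1, h2⟩
    · exact Or.inl h1
    · exact Or.inr ⟨Or.inl h1, h2⟩
  · have : (Zp * Ym).natDegree < N := by
      rw [natDegree_mul hZ1 hY2]
      rw [natDegree_mul hY1 hZ2] at hgt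
      omega
    rcases h'.exists_factor h hP.symm (hP ▸ hP0) hZp hYp (hP ▸ hN) this with h1 | ⟨h1, h2⟩
    · exact Or.inl h1.symm
    · exact Or.inr ⟨Or.inr h1, h2⟩

/-- Uniqueness of partial fractions with coprime denominators. -/
theorem IsSplitting.slope_eq {Ep Em Ep' Em' : ℝ[X]} {w u : ℝ}
    (hs : IsSplitting W Yp Ep Ym Em w u) (hs' : IsSplitting W Yp Ep' Ym Em' w u)
    (hcop : IsCoprime Yp Ym) : Ep' = Ep ∧ Em' = Em := by
  have h1 : (Ep' - Ep) * Ym = -((Em' - Em) * Yp) := by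
    apply mul_left_cancel₀ (X_ne_zero (R := ℝ))
    linear_combination hs'.eq - hs.eq
  have h2 : Yp ∣ Ep' - Ep := hcop.dvd_of_dvd_mul_right (by
    rw [h1]; exact (dvd_neg.2 (dvd_mul_left _ _)))
  have h3 : Ep' - Ep = 0 := eq_zero_of_dvd_of_degree_lt h2
    ((degree_sub_le _ _).trans_lt (max_lt hs'.right.degree_lt hs.right.degree_lt))
  rw [h3, zero_mul, eq_comm, neg_eq_zero, mul_eq_zero] at h1
  exact ⟨sub_eq_zero.1 h3, sub_eq_zero.1 (h1.resolve_right hs.right.ne_zero)⟩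

end Data

/-! ### Construction of a second factorisation -/

/-- At the largest node the derivative of `C k * nodal` has the sign of `k`, so `F` has the opposite
sign there, while at `+∞` it has the sign of `k`. -/
theorem exists_root_above {N : ℕ} {lam : Fin N → ℝ} {k : ℝ} {F : ℝ[X]}
    (hlam : Function.Injective lam) (hN : 0 < N) (hF : 0 < F.natDegree)
    (hlc : 0 < F.leadingCoeff * k)
    (hval : ∀ i, F.eval (lam i) *
      (derivative (C k * Lagrange.nodal Finset.univ lam)).eval (lam i) < 0) :
    ∃ μ, F.eval μ = 0 ∧ ∀ i, lam i < μ := by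
  have : Nonempty (Fin N) := ⟨⟨0, hN⟩⟩
  obtain ⟨j, hj⟩ := Finite.exists_max lam
  have h1 := hval j
  rw [eval_derivative_C_mul_nodal (Finset.mem_univ j), Lagrange.eval_nodal] at h1
  have h2 : 0 < ∏ i ∈ Finset.univ.erase j, (lam j - lam i) := Finset.prod_pos fun i hi =>
    sub_pos.2 ((hj i).lt_of_ne fun h => (Finset.mem_erase.1 hi).1 (hlam h))
  have h3 : k * F.eval (lam j) < 0 := by
    by_contra hcon
    have := mul_nonneg (not_lt.1 hcon) h2.le
    linarith
  have hk : k ≠ 0 := right_ne_zero_of_mul hlc.ne'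
  have ht := (C k * F).tendsto_atTop_of_leadingCoeff_nonneg
    (by rw [degree_C_mul hk]; exact natDegree_pos_iff_degree_pos.1 hF)
    (by rw [leadingCoeff_mul, leadingCoeff_C, mul_comm]; exact hlc.le)
  obtain ⟨x, hx1, hx2⟩ := ((ht.eventually_gt_atTop 0).and
    (Filter.eventually_gt_atTop (lam j))).exists
  obtain ⟨μ, hμ, hμ0⟩ := intermediate_value_Ioo hx2.le (C k * F).continuous.continuousOn
    (show (0 : ℝ) ∈ Set.Ioo _ _ by
      refine ⟨?_, hx1⟩
      rw [eval_mul, eval_C]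
      exact h3)
  have hμ0' : k * F.eval μ = 0 := by rw [← hμ0]; simp
  exact ⟨μ, (mul_eq_zero.1 hμ0').resolve_left hk, fun i => (hj i).trans_lt hμ.1⟩

theorem exists_root_below {N : ℕ} {lam : Fin N → ℝ} {k : ℝ} {F : ℝ[X]}
    (hlam : Function.Injective lam) (hN : 0 < N) (hF : F.natDegree = N)
    (hlc : F.leadingCoeff * k < 0)
    (hval : ∀ i, F.eval (lam i) *
      (derivative (C k * Lagrange.nodal Finset.univ lam)).eval (lam i) < 0) :
    ∃ μ, F.eval μ = 0 ∧ ∀ i, μ < lam i := by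
  have hX : (-X : ℝ[X]).natDegree = 1 := by rw [natDegree_neg, natDegree_X]
  have hnodal : C (k * (-1) ^ N) * Lagrange.nodal Finset.univ (fun i => -lam i) =
      (C k * Lagrange.nodal Finset.univ lam).comp (-X) := by
    have : ∀ i, -X - C (lam i) = -(X - C (-lam i)) := fun i => by rw [C_neg]; ring
    rw [Lagrange.nodal, Lagrange.nodal, mul_comp, C_comp, Polynomial.prod_comp]
    simp only [sub_comp, X_comp, C_comp, this, Finset.prod_neg, Finset.card_univ, Fintype.card_fin,
      C_mul, C_pow, C_neg, C_1]
    ring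
  -- Apply the previous case after `z ↦ -z`. The factor `(-1)^N` restores the nodal normalisation,
  -- and the sign of `F` is flipped to compensate the chain rule.
  obtain ⟨μ, hμ, hμ'⟩ := exists_root_above (lam := fun i => -lam i) (k := k * (-1) ^ N)
    (F := -(F.comp (-X))) (fun i j h => hlam (neg_injective h)) hN
    (by rw [natDegree_neg, natDegree_comp, hX, hF, mul_one]; exact hN)
    (by
      have h1 : ((-1 : ℝ) ^ N) * (-1) ^ N = 1 := by rw [← mul_pow]; simp
      rw [leadingCoeff_neg, leadingCoeff_comp (by rw [hX]; exact one_ne_zero), leadingCoeff_neg,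
        leadingCoeff_X, hF]
      have : -(F.leadingCoeff * (-1) ^ N) * (k * (-1) ^ N) = -(F.leadingCoeff * k) := by
        linear_combination (-(F.leadingCoeff * k)) * h1
      rw [this]
      linarith)
    (fun i => by
      have h1 := hval i
      rw [hnodal, derivative_comp]
      simp only [eval_neg, eval_mul, eval_comp, eval_X, neg_neg, derivative_neg, derivative_X,
        eval_one]
      linarith)
  refine ⟨-μ, ?_, fun i => ?_⟩
  · simpa using hμ
  · have := hμ' i
    linarith

section Data

variable {N : ℕ} {lam p : Fin N → ℝ} {W Yp Ym : ℝ[X]}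

/-- `X * P / W` is Herglotz with limit `β` at infinity, so the sign of `β` decides on which side of
the spectrum the outer zero lies. Eigenvalues of both signs keep it away from `0` and make `1 - z /
μ` positive on the spectrum. -/
theorem HasData.exists_root_outside (h : HasData lam p W Yp Ym) (hp : ∀ i, p i ≠ 0)
    (hP0 : (Yp * Ym).eval 0 = 1) (hN : (Yp * Ym).natDegree + 1 = N) {β : ℝ} (hβ : β ≠ 0)
    (hlc : (Yp * Ym).leadingCoeff = W.leadingCoeff * β)
    (hneg : ∃ i, lam i < 0) (hpos : ∃ i, 0 < lam i) :
    ∃ μ, (Yp * Ym).eval μ = 0 ∧ ∀ i, 0 < 1 - μ⁻¹ * lam i := by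
  set P := Yp * Ym with hP
  have hP00 : P ≠ 0 := fun h0 => by simp [h0] at hP0
  have hW0 := leadingCoeff_ne_zero.2 h.ne_zero
  have hd : (X * P).natDegree = N := by rw [mul_comm, natDegree_mul_X hP00, hN]
  have hl : (X * P).leadingCoeff * W.leadingCoeff = W.leadingCoeff ^ 2 * β := by
    rw [leadingCoeff_mul, leadingCoeff_X, hlc]; ring
  have hsq : 0 < W.leadingCoeff ^ 2 := by positivity
  have hval : ∀ i, (X * P).eval (lam i) *
      (derivative (C W.leadingCoeff * Lagrange.nodal Finset.univ lam)).eval (lam i) < 0 := by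
    intro i
    rw [← h.eq_nodal, eval_mul, eval_X, h.value]
    have h1 := h.lam_ne_zero i
    have h2 := h.derivative_ne_zero i
    have h3 := hp i
    have : 0 < (lam i) ^ 2 * (derivative W).eval (lam i) ^ 2 * p i ^ 2 := by positivity
    linarith
  have hroot : ∀ μ, μ ≠ 0 → (X * P).eval μ = 0 → P.eval μ = 0 := fun μ h0 h1 => by
    rw [eval_mul, eval_X] at h1
    exact (mul_eq_zero.1 h1).resolve_left h0
  obtain ⟨i, hi⟩ := hneg
  obtain ⟨j, hj⟩ := hpos
  rcases hβ.lt_or_gt with hb | hb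
  · obtain ⟨μ, h1, h2⟩ := exists_root_below h.strictMono.injective (by omega) hd
      (by rw [hl]; exact mul_neg_of_pos_of_neg hsq hb) hval
    have hμ : μ < 0 := (h2 i).trans hi
    refine ⟨μ, hroot μ hμ.ne h1, fun n => ?_⟩
    have : 1 - μ⁻¹ * lam n = (lam n - μ) / (-μ) := by field_simp [hμ.ne]; ring
    rw [this]
    exact div_pos (sub_pos.2 (h2 n)) (neg_pos.2 hμ)
  · obtain ⟨μ, h1, h2⟩ := exists_root_above h.strictMono.injective (by omega)
      (by rw [hd]; omega) (by rw [hl]; exact mul_pos hsq hb) hval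
    have hμ : 0 < μ := hj.trans (h2 j)
    refine ⟨μ, hroot μ hμ.ne' h1, fun n => ?_⟩
    have : 1 - μ⁻¹ * lam n = (μ - lam n) / μ := by field_simp
    rw [this]
    exact div_pos (sub_pos.2 (h2 n)) hμ

theorem exists_eq_linear_mul {Q : ℝ[X]} {μ : ℝ} (hμ : μ ≠ 0) (h : Q.eval μ = 0)
    (h0 : Q.eval 0 = 1) : ∃ R : ℝ[X], Q = (1 - C μ⁻¹ * X) * R ∧ R.eval 0 = 1 := by
  obtain ⟨R, hR⟩ := dvd_iff_isRoot.2 (show IsRoot Q μ from h)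
  have hC : C μ⁻¹ * C μ = (1 : ℝ[X]) := by rw [← C_mul, inv_mul_cancel₀ hμ, C_1]
  have hQ : Q = (1 - C μ⁻¹ * X) * (-C μ * R) := by
    rw [hR]
    linear_combination (-X * R) * hC
  refine ⟨_, hQ, ?_⟩
  rw [hQ] at h0
  simpa using h0

theorem natDegree_linear_mul {μ : ℝ} (hμ : μ ≠ 0) {R : ℝ[X]} (hR : R ≠ 0) :
    ((1 - C μ⁻¹ * X) * R).natDegree = R.natDegree + 1 := by
  have h1 : (1 - C μ⁻¹ * X : ℝ[X]) = C (-μ⁻¹) * X + C 1 := by rw [C_neg, C_1]; ring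
  have h2 : (C (-μ⁻¹) * X + C 1 : ℝ[X]).natDegree = 1 :=
    natDegree_linear (neg_ne_zero.2 (inv_ne_zero hμ))
  rw [h1, natDegree_mul (fun h0 => by rw [h0, natDegree_zero] at h2; omega) hR, h2, add_comm]

theorem HasData.exists_other (h : HasData lam p W Yp Ym) (hYp : Yp.eval 0 = 1)
    (hYm : Ym.eval 0 = 1) {μ : ℝ} (hμ : (Yp * Ym).eval μ = 0)
    (hpos : ∀ i, 0 < 1 - μ⁻¹ * lam i) :
    ∃ Zp Zm, HasData lam p W Zp Zm ∧ Yp * Ym = Zp * Zm ∧ Zp.eval 0 = 1 ∧ Zm.eval 0 = 1 ∧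
      Zp ≠ Yp := by
  have hμ0 : μ ≠ 0 := by
    rintro rfl
    rw [eval_mul, hYp, hYm, one_mul] at hμ
    exact one_ne_zero hμ
  have hev : ∀ i, (1 - C μ⁻¹ * X : ℝ[X]).eval (lam i) = 1 - μ⁻¹ * lam i := fun i => by simp
  have hne : ∀ {R : ℝ[X]}, R.eval 0 = 1 → R ≠ 0 := fun h1 h0 => by simp [h0] at h1
  rw [eval_mul] at hμ
  -- The factor that vanishes at `μ` hands `1 - z / μ` over to the other one; the product and the
  -- signs at the eigenvalues are unchanged.
  rcases mul_eq_zero.1 hμ with h1 | h1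
  · obtain ⟨R, hR, hR0⟩ := exists_eq_linear_mul hμ0 h1 hYp
    have hPR : Yp * Ym = R * ((1 - C μ⁻¹ * X) * Ym) := by rw [hR]; ring
    refine ⟨R, (1 - C μ⁻¹ * X) * Ym, ⟨h.strictMono, h.roots, h.eval_zero, h.derivative_ne_zero,
      fun i => by rw [← hPR, h.value], fun i => ?_⟩, hPR, hR0, by simp [hYm], fun heq => ?_⟩
    · have h2 := h.sign i
      rw [hR, eval_mul, hev, mul_assoc] at h2
      exact pos_of_mul_pos_right h2 (hpos i).le
    · have := natDegree_linear_mul hμ0 (hne hR0)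
      rw [← hR, heq] at this
      omega
  · obtain ⟨R, hR, hR0⟩ := exists_eq_linear_mul hμ0 h1 hYm
    have hPR : Yp * Ym = ((1 - C μ⁻¹ * X) * Yp) * R := by rw [hR]; ring
    refine ⟨(1 - C μ⁻¹ * X) * Yp, R, ⟨h.strictMono, h.roots, h.eval_zero, h.derivative_ne_zero,
      fun i => by rw [← hPR, h.value], fun i => ?_⟩, hPR, by simp [hYp], hR0, fun heq => ?_⟩
    · rw [eval_mul, hev, mul_assoc]
      exact mul_pos (hpos i) (h.sign i)
    · have := natDegree_linear_mul hμ0 (hne hYp)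
      rw [heq] at this
      omega

theorem exists_partial_fraction {F G R : ℝ[X]} (hF : F ≠ 0) (hG : G ≠ 0) (h : IsCoprime F G)
    (hR : R.degree < (F * G).degree) :
    ∃ A B : ℝ[X], R = A * G + B * F ∧ A.degree < F.degree ∧ B.degree < G.degree := by
  obtain ⟨a, b, hab⟩ := h
  have hdm := EuclideanDomain.div_add_mod (R * b) F
  have hA : ((R * b) % F).degree < F.degree := EuclideanDomain.mod_lt _ hF
  have heq : R = (R * b) % F * G + (R * a + (R * b) / F * G) * F := by
    linear_combination (-R) * hab - G * hdm
  refine ⟨_, _, heq, hA, ?_⟩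
  have h1 : ((R * a + (R * b) / F * G) * F).degree < (G * F).degree := by
    have h2 : (R * a + (R * b) / F * G) * F = R - (R * b) % F * G := by linear_combination -heq
    rw [h2, mul_comm G]
    refine (degree_sub_le _ _).trans_lt (max_lt hR ?_)
    rw [degree_mul, degree_mul]
    exact WithBot.add_lt_add_right (degree_ne_bot.2 hG) hA
  rw [degree_mul, degree_mul] at h1
  exact lt_of_add_lt_add_right h1

/-- At a zero of `Zp` only the `Ep` term of `W` survives, so `-W / (X * Zp * Zm)` and `Ep / Zp` have
the same residue there. -/
theorem IsNevanlinna.of_factor {Zp Zm Ep Em V : ℝ[X]} (h : IsNevanlinna (-W) (X * (Zp * Zm)))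
    (hZp : Zp.eval 0 = 1) (hEp : Ep.degree < Zp.degree)
    (hW : W = V * (Zp * Zm) - X * Ep * Zm - X * Em * Zp) : IsNevanlinna Ep Zp := by
  have hZ0 : Zp ≠ 0 := fun h0 => by simp [h0] at hZp
  refine ⟨hZ0, h.splits.of_dvd h.ne_zero ⟨X * Zm, by ring⟩, fun μ hμ => ?_, ?_, ?_⟩
  · have hW' : W.eval μ = -(μ * Ep.eval μ * Zm.eval μ) := by
      rw [hW]; simp [hμ]
    have h1 := h.residue μ (by simp [hμ])
    simp only [derivative_mul, derivative_X, eval_add, eval_mul, eval_neg, eval_X, eval_one, hμ,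
      hW'] at h1
    by_contra hcon
    have := mul_nonneg (not_lt.1 hcon) (sq_nonneg (μ * Zm.eval μ))
    nlinarith
  · have := natDegree_le_natDegree hEp.le
    omega
  · rw [coeff_eq_zero_of_natDegree_lt, zero_mul]
    have := natDegree_le_natDegree hEp.le
    omega

theorem IsNevanlinna.C_mul {M Q : ℝ[X]} (h : IsNevanlinna M Q) {r : ℝ} (hr : 0 < r) :
    IsNevanlinna (C r * M) Q := by
  refine ⟨h.ne_zero, h.splits, fun μ hμ => ?_, ?_, ?_⟩
  · rw [eval_mul, eval_C, mul_assoc]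
    exact mul_neg_of_pos_of_neg hr (h.residue μ hμ)
  · rw [natDegree_C_mul hr.ne']
    exact h.natDegree_le
  · rw [coeff_C_mul, mul_assoc]
    exact mul_nonneg hr.le h.slope

end Data

/-! ### Back to measures -/

section Measures

variable {L : List Node} {ω : ℝ →₀ ℝ} {v : ℝ →₀ ℝ≥0}

theorem IsAbove.isHalf {a : ℝ} (h : IsAbove a L) (b : ℝ) :
    IsHalf (valuePoly a L) (C (Real.exp b) * slopePoly L) := by
  have hb := (Real.exp_pos b).ne'
  obtain ⟨k, hk, hdeg⟩ := exists_degree_X_mul_slopePoly_add_lt h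
  refine ⟨eval_zero_valuePoly a L, by rw [degree_C_mul hb]; exact degree_slopePoly_lt h,
    Real.exp b * k, by positivity, ?_⟩
  have : X * (C (Real.exp b) * slopePoly L) + C (Real.exp b * k) * valuePoly a L =
      C (Real.exp b) * (X * slopePoly L + C k * valuePoly a L) := by
    rw [C_mul]; ring
  rwa [this, degree_C_mul hb]

theorem Represents.isSplitting (h : Represents L ω v) (a : ℝ) :
    IsSplitting (wronskiPoly L) (valuePoly a (above a L)) (C (Real.exp a) * slopePoly (above a L))
      (valuePoly (-a) (belowReflect a L)) (C (Real.exp (-a)) * slopePoly (belowReflect a L))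
      (ω a) (v a) := by
  refine ⟨(h.isAbove_above a).isHalf a, (h.isAbove_belowReflect a).isHalf (-a), ?_⟩
  have h1 := wronskiPoly_split (reflect (belowReflect a L)) (above a L) (a, ω a, (v a : ℝ))
  rw [reflect_reflect, weight_X] at h1
  rw [← h1, wronskiPoly, wronskiPoly, h.state_split a]

theorem Represents.hasData_iff (h : Represents L ω v) (a : ℝ) {N : ℕ}
    {lam p : Fin N → ℝ} (hp : ∀ i, p i ≠ 0) :
    IsInteriorSpectralData a ω v lam p ↔ HasData lam p (wronskiPoly L)
      (valuePoly a (above a L)) (valuePoly (-a) (belowReflect a L)) := by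
  rw [h.isInteriorSpectralData_iff a hp]
  exact ⟨fun ⟨h1, h2, h3⟩ => ⟨h1, h2, eval_zero_wronskiPoly L, fun i => (h3 i).1,
    fun i => (h3 i).2.1, fun i => (h3 i).2.2⟩, fun h => ⟨h.strictMono, h.roots,
    fun i => ⟨h.derivative_ne_zero i, h.value i, h.sign i⟩⟩⟩

theorem Represents.eq_of_halves {L' : List Node} {ω' : ℝ →₀ ℝ} {v' : ℝ →₀ ℝ≥0}
    (h : Represents L ω v) (h' : Represents L' ω' v') (a : ℝ) (hω : ω' a = ω a) (hv : v' a = v a)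
    (h1 : above a L' = above a L) (h2 : belowReflect a L' = belowReflect a L) :
    ω' = ω ∧ v' = v := by
  have h3 : (L'.filter fun n => n.1 < a) = L.filter fun n => n.1 < a := by
    have := congrArg reflect h2
    simpa [belowReflect] using this
  have h4 : (L'.filter fun n => n.1 = a) = L.filter fun n => n.1 = a := by
    have hnode : IsNode ω' v' a ↔ IsNode ω v a := by simp [IsNode, hω, hv]
    rcases h.filter_eq_cases a with ⟨h5, h6⟩ | ⟨h5, h6⟩ <;>
      rcases h'.filter_eq_cases a with ⟨h7, h8⟩ | ⟨h7, h8⟩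
    · rw [h6, h8, hω, hv]
    · exact absurd (hnode.2 h5) h7
    · exact absurd (hnode.1 h7) h5
    · rw [h6, h8]
  have hL : L' = L := by
    rw [filter_append_eq h.sorted a, filter_append_eq h'.sorted a, h1, h3, h4]
  exact h.measures_eq (hL ▸ h')

theorem exists_represents_of_halves {a w : ℝ} (hw : w ≠ 0) {L₁ L₂ : List Node}
    (h₁ : IsAbove (-a) L₁) (h₂ : IsAbove a L₂) :
    ∃ (L : List Node) (ω : ℝ →₀ ℝ) (v : ℝ →₀ ℝ≥0), Represents L ω v ∧ ω a = w ∧ v a = 0 ∧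
      above a L = L₂ ∧ belowReflect a L = L₁ := by
  obtain ⟨hs₁, hm₁⟩ := isAbove_iff.1 h₁
  obtain ⟨hs₂, hm₂⟩ := isAbove_iff.1 h₂
  have hm₁' : ∀ n ∈ reflect L₁, n.1 < a ∧ (n.2.1 ≠ 0 ∨ n.2.2 ≠ 0) ∧ 0 ≤ n.2.2 := fun n hn => by
    obtain ⟨h1, h2⟩ := hm₁ _ (mem_reflect.1 hn)
    exact ⟨by simpa using h1, h2⟩
  obtain ⟨ω, v, h⟩ := exists_measures_of_list (L := reflect L₁ ++ (a, w, 0) :: L₂) (by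
      rw [List.pairwise_append, List.pairwise_cons]
      refine ⟨pairwise_reflect hs₁, ⟨fun m hm => (hm₂ m hm).1, hs₂⟩, fun m hm n hn => ?_⟩
      rcases List.mem_cons.1 hn with rfl | hn
      · exact (hm₁' m hm).1
      · exact (hm₁' m hm).1.trans (hm₂ n hn).1)
    (fun n hn => by
      rcases List.mem_append.1 hn with hn | hn
      · exact (hm₁' n hn).2
      · rcases List.mem_cons.1 hn with rfl | hn
        · exact ⟨Or.inl hw, le_rfl⟩
        · exact (hm₂ n hn).2)
  obtain ⟨-, hωa, hva⟩ := (h.mem_iff (a, w, 0)).1 (by simp)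
  refine ⟨_, ω, v, h, hωa.symm, NNReal.coe_injective hva.symm, ?_, ?_⟩
  · have e1 : (reflect L₁).filter (fun n => a < n.1) = [] :=
      List.filter_eq_nil_iff.2 fun n hn => by simpa using (hm₁' n hn).1.le
    have e2 : L₂.filter (fun n => a < n.1) = L₂ :=
      List.filter_eq_self.2 fun n hn => by simpa using (hm₂ n hn).1
    simp only [above, List.filter_append, List.filter_cons, e1, e2]
    simp
  · have e1 : (reflect L₁).filter (fun n => n.1 < a) = reflect L₁ :=
      List.filter_eq_self.2 fun n hn => by simpa using (hm₁' n hn).1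
    have e2 : L₂.filter (fun n => n.1 < a) = [] :=
      List.filter_eq_nil_iff.2 fun n hn => by simpa using (hm₂ n hn).1.le
    simp only [belowReflect, List.filter_append, List.filter_cons, e1, e2]
    simp

/-- Interior spectral data whose node at `a` carries only an `ω`-mass determine the Wronski
polynomial, the product of the value polynomials and the mass; the pair of measures is determined
by the value polynomial on the right. -/
theorem measures_eq_or_natDegree (a : ℝ) {N : ℕ} {lam p : Fin N → ℝ} (hp : ∀ i, p i ≠ 0)
    (hα : 1 - ∑ i, p i ^ 2 = 0) (hβ : -∑ i, lam i * p i ^ 2 ≠ 0)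
    {L' : List Node} {ω' : ℝ →₀ ℝ} {v' : ℝ →₀ ℝ≥0} (h : Represents L ω v)
    (h' : Represents L' ω' v') (hd : IsInteriorSpectralData a ω v lam p)
    (hd' : IsInteriorSpectralData a ω' v' lam p) :
    (ω' = ω ∧ v' = v) ∨
      (((valuePoly a (above a L')).natDegree = (valuePoly a (above a L)).natDegree + 1 ∨
        (valuePoly a (above a L)).natDegree = (valuePoly a (above a L')).natDegree + 1) ∧
        ¬ ((∀ i, 0 < lam i) ∨ ∀ i, lam i < 0)) := by
  have hs := h.isSplitting a
  have hs' := h'.isSplitting a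
  have hD := (h.hasData_iff a hp).1 hd
  have hD' := (h'.hasData_iff a hp).1 hd'
  have hW : wronskiPoly L' = wronskiPoly L := hD.eq_of_hasData hD'
  rw [hW] at hD' hs'
  obtain ⟨hN, hu, -, hw, -⟩ := hD.splitting_facts hs hα hβ
  obtain ⟨hN', hu', -, hw', -⟩ := hD'.splitting_facts hs' hα hβ
  -- Both products have degree `N - 1` and agree at the `N` eigenvalues.
  have hP : valuePoly a (above a L) * valuePoly (-a) (belowReflect a L) =
      valuePoly a (above a L') * valuePoly (-a) (belowReflect a L') := by
    refine eq_of_degrees_lt_of_eval_index_eq Finset.univ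
      (hD.strictMono.injective.injOn) ?_ ?_ fun i _ => by rw [hD.value, hD'.value]
    all_goals
      rw [Finset.card_univ, Fintype.card_fin]
      refine degree_le_natDegree.trans_lt ?_
      exact_mod_cast (by omega)
  have hP0 : (valuePoly a (above a L) * valuePoly (-a) (belowReflect a L)).eval 0 = 1 := by
    rw [eval_mul, eval_zero_valuePoly, eval_zero_valuePoly, one_mul]
  refine (hD.eq_or_natDegree hD' hP hP0 (eval_zero_valuePoly _ _) (eval_zero_valuePoly _ _)
    hN).imp_left fun hY => ?_
  -- Comparing the candidate with itself shows that `P` has simple zeros.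
  have hcop := (hD.isNevanlinna_inv hD rfl (by omega)).isCoprime
  have hYm : valuePoly (-a) (belowReflect a L) = valuePoly (-a) (belowReflect a L') := by
    rw [← hY] at hP
    exact mul_left_cancel₀ (valuePoly_ne_zero _ _) hP
  have hωa : ω' a = ω a := mul_right_cancel₀ hβ (hw'.trans hw.symm)
  have hva : v' a = v a := NNReal.coe_injective (hu'.trans hu.symm)
  rw [← hY, ← hYm, hωa, hva] at hs'
  obtain ⟨hE1, hE2⟩ := hs.slope_eq hs' hcop
  have hC : ∀ b : ℝ, C (Real.exp b) ≠ (0 : ℝ[X]) := fun b => C_ne_zero.2 (Real.exp_pos b).ne'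
  exact h.eq_of_halves h' a hωa hva
    (list_ext_of_polys (h'.isAbove_above a) (h.isAbove_above a) hY.symm
      (mul_left_cancel₀ (hC _) hE1))
    (list_ext_of_polys (h'.isAbove_belowReflect a) (h.isAbove_belowReflect a) hYm.symm
      (mul_left_cancel₀ (hC _) hE2))

/-- Keep `W`, `P` and the mass at `a`, move one linear factor of `P` to the other side, and rebuild
both half-lines from the new factors. -/
theorem exists_other_measures (a : ℝ) {N : ℕ} {lam p : Fin N → ℝ} (hp : ∀ i, p i ≠ 0)
    (hα : 1 - ∑ i, p i ^ 2 = 0) (hβ : -∑ i, lam i * p i ^ 2 ≠ 0) (h : Represents L ω v)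
    (hd : IsInteriorSpectralData a ω v lam p) (hneg : ∃ i, lam i < 0) (hpos : ∃ i, 0 < lam i) :
    ∃ (ω' : ℝ →₀ ℝ) (v' : ℝ →₀ ℝ≥0), IsInteriorSpectralData a ω' v' lam p ∧ (ω', v') ≠ (ω, v) := by
  have hs := h.isSplitting a
  have hD := (h.hasData_iff a hp).1 hd
  obtain ⟨hN, hu, hw0, -, hlc⟩ := hD.splitting_facts hs hα hβ
  have hP0 : (valuePoly a (above a L) * valuePoly (-a) (belowReflect a L)).eval 0 = 1 := by
    rw [eval_mul, eval_zero_valuePoly, eval_zero_valuePoly, one_mul]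
  obtain ⟨μ, hμ, hμpos⟩ := hD.exists_root_outside hp hP0 hN hβ hlc hneg hpos
  obtain ⟨Zp, Zm, hZ, hPZ, hZp, hZm, hZne⟩ :=
    hD.exists_other (eval_zero_valuePoly _ _) (eval_zero_valuePoly _ _) hμ hμpos
  have hnev := hZ.isNevanlinna_inv hZ rfl (by rw [← hPZ]; omega)
  have hZp0 : Zp ≠ 0 := fun h0 => by simp [h0] at hZp
  have hZm0 : Zm ≠ 0 := fun h0 => by simp [h0] at hZm
  -- The combined slope term of `W` is kept; only its partial fraction decomposition is redone over
  -- the new denominators.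
  obtain ⟨Ep, Em, hE, hEp, hEm⟩ := exists_partial_fraction (F := Zp) (G := Zm)
    (R := C (Real.exp a) * slopePoly (above a L) * valuePoly (-a) (belowReflect a L) +
      C (Real.exp (-a)) * slopePoly (belowReflect a L) * valuePoly a (above a L)) hZp0 hZm0
    hnev.isCoprime (by
      rw [← hPZ]
      refine (degree_add_le _ _).trans_lt (max_lt ?_ ?_)
      · rw [degree_mul (p := _ * _), degree_mul (p := valuePoly _ _)]
        exact WithBot.add_lt_add_right (degree_ne_bot.2 hs.left.ne_zero) hs.right.degree_lt
      · rw [degree_mul (p := _ * _), degree_mul (p := valuePoly _ _),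
          add_comm (valuePoly a (above a L)).degree]
        exact WithBot.add_lt_add_right (degree_ne_bot.2 hs.right.ne_zero) hs.left.degree_lt)
  have hW : wronskiPoly L = (1 - X * (C (ω a) + C 0 * X)) * (Zp * Zm) - X * Ep * Zm - X * Em * Zp := by
    have h1 := hs.eq
    rw [hu] at h1
    rw [← hPZ]
    linear_combination h1 + (-X) * hE
  have hNp : IsNevanlinna Ep Zp := hnev.of_factor hZp hEp hW
  have hNm : IsNevanlinna Em Zm := IsNevanlinna.of_factor (Zm := Zp) (Em := Ep)
    (V := 1 - X * (C (ω a) + C 0 * X))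
    (by rw [mul_comm Zm]; exact hnev) hZm hEm (by rw [mul_comm Zm]; linear_combination hW)
  have hdeg : ∀ {F G : ℝ[X]} (b : ℝ), F.degree < G.degree →
      (C (Real.exp b) * F).degree < G.degree := fun b hFG => by
    rwa [degree_C_mul (Real.exp_pos b).ne']
  -- The factor `exp (-a)` undoes the scaling `exp a` of the slope polynomial in
  -- `Represents.isSplitting`; on the left the roles are exchanged.
  obtain ⟨L₂, hL₂, hY₂, hE₂⟩ := exists_list_of_isNevanlinna a
    (hNp.C_mul (Real.exp_pos (-a))) (hdeg _ hEp) hZp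
  obtain ⟨L₁, hL₁, hY₁, hE₁⟩ := exists_list_of_isNevanlinna (-a)
    (hNm.C_mul (Real.exp_pos a)) (hdeg _ hEm) hZm
  obtain ⟨L', ω', v', h', hωa, hva, hab, hbe⟩ := exists_represents_of_halves hw0 hL₁ hL₂
  have hs' := h'.isSplitting a
  have hexp : C (Real.exp a) * C (Real.exp (-a)) = (1 : ℝ[X]) := by
    rw [← C_mul, ← Real.exp_add]; simp
  have hW' : wronskiPoly L' = wronskiPoly L := by
    have h1 := hs'.eq
    rw [hab, hbe, hY₁, hY₂, hE₁, hE₂, hωa, hva, NNReal.coe_zero] at h1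
    rw [h1, hW]
    linear_combination (-(X * Ep * Zm) - X * Em * Zp) * hexp
  refine ⟨ω', v', (h'.hasData_iff a hp).2 ?_, fun heq => hZne ?_⟩
  · rw [hW', hab, hbe, hY₁, hY₂]
    exact hZ
  · obtain ⟨rfl, rfl⟩ := Prod.ext_iff.1 heq
    have hL : L' = L := by
      refine List.Perm.eq_of_pairwise (le := fun m n : Node => m.1 < n.1)
        (fun m n _ _ h1 h2 => absurd h1 h2.not_gt) h'.sorted h.sorted ?_
      refine (List.perm_ext_iff_of_nodup ?_ ?_).2 fun n => by rw [h.mem_iff, h'.mem_iff]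
      · exact h'.sorted.imp fun {m n} hlt heq => by rw [heq] at hlt; exact lt_irrefl _ hlt
      · exact h.sorted.imp fun {m n} hlt heq => by rw [heq] at hlt; exact lt_irrefl _ hlt
    rw [← hY₂, ← hab, hL]

end Measures

end CHSpectral

theorem mainTheorem6 (a : ℝ) (ω : ℝ →₀ ℝ) (v : ℝ →₀ NNReal) (N : ℕ) (lam p : Fin N → ℝ)
    (hdata : CHSpectral.IsInteriorSpectralData a ω v lam p)
    (hα : 1 - ∑ i, |p i| ^ 2 = 0)
    (hβ : -∑ i, lam i * |p i| ^ 2 ≠ 0)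
    (hp : ∀ i, p i ≠ 0) :
    (((∀ i, 0 < lam i) ∨ (∀ i, lam i < 0)) →
      ∀ (ω' : ℝ →₀ ℝ) (v' : ℝ →₀ NNReal),
        CHSpectral.IsInteriorSpectralData a ω' v' lam p → ω' = ω ∧ v' = v) ∧
    (((∃ i, lam i < 0) ∧ (∃ i, 0 < lam i)) →
      {q : (ℝ →₀ ℝ) × (ℝ →₀ NNReal) |
        CHSpectral.IsInteriorSpectralData a q.1 q.2 lam p}.encard = 2) := by
  simp only [sq_abs] at hα hβ
  obtain ⟨L, hL⟩ := CHSpectral.exists_represents ω v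
  constructor
  · intro hsign ω' v' hdata'
    obtain ⟨L', hL'⟩ := CHSpectral.exists_represents ω' v'
    rcases CHSpectral.measures_eq_or_natDegree a hp hα hβ hL hL' hdata hdata' with h | ⟨-, h⟩
    · exact h
    · exact absurd hsign h
  · rintro ⟨hneg, hpos⟩
    obtain ⟨ω', v', hdata', hne⟩ :=
      CHSpectral.exists_other_measures a hp hα hβ hL hdata hneg hpos
    obtain ⟨L', hL'⟩ := CHSpectral.exists_represents ω' v'
    rw [Set.encard_eq_two]
    refine ⟨(ω, v), (ω', v'), hne.symm, Set.ext fun q => ⟨fun hq => ?_, ?_⟩⟩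
    · obtain ⟨M, hM⟩ := CHSpectral.exists_represents q.1 q.2
      rcases CHSpectral.measures_eq_or_natDegree a hp hα hβ hL hM hdata hq with h1 | ⟨h1, -⟩
      · exact Or.inl (Prod.ext h1.1 h1.2)
      rcases CHSpectral.measures_eq_or_natDegree a hp hα hβ hL' hM hdata' hq with h2 | ⟨h2, -⟩
      · exact Or.inr (Prod.ext h2.1 h2.2)
      rcases CHSpectral.measures_eq_or_natDegree a hp hα hβ hL hL' hdata hdata' with h3 | ⟨h3, -⟩
      · exact absurd (Prod.ext h3.1 h3.2) hne
      -- Three natural numbers cannot pairwise differ by exactly one.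
      · omega
    · rintro (rfl | rfl)
      · exact hdata
      · exact hdata'
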